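/- **Setting.** Let $\mathbb F_q$ be a finite field. A model consists of $L=P\ell$ parameters in $\mathbb F_q$, grouped into $P$ subpackets of $\ell\ge 1$ parameters, and the subpackets are divided into $B$ consecutive segments of equal size $P/B$, where $1\le B<P$ and $B\mid P$. It is stored on $N$ non-colluding databases. In one round, a user first downloads $Pr'$ subpackets, chosen arbitrarily by the databases through permuted indices (reading phase), and then uploads updates of $Pr$ subpackets (writing phase); $Pr$ and $Pr'$ are integers. Let $X$ be the set of indices of the $Pr$ updated subpackets, $\hat X_i$ the number of them in segment $i$, and $(\tilde X_1,\dots,\tilde X_B)$ the tuple $(\hat X_1,\dots,\hat X_B)$ irrespective of order (a multiset). The model $W$, the set $X$ and the update values $\Delta$ have an arbitrary joint law and are independent of the scheme's random permutations and noise symbols, all of which are independent and uniform. Costs are counted in $q$-ary symbols (an element of a finite set $A$ counts as $\log_q|A|$): the reading (writing) cost is the total number of symbols downloaded (uploaded), including permuted indices, divided by $L$; the storage complexity is the order of the number of symbols stored in each database. **Schemes.** Let $\alpha_1,\dots,\alpha_N\in\mathbb F_q$ be distinct and, in the uncoded cases 1 and 3, let $f_1,\dots,f_\ell\in\mathbb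 F_q$ be distinct and different from all $\alpha_n$; in the coded cases 2 and 4 let all $\alpha_n$ be nonzero (such constants exist when $q$ is large enough). Write $\Gamma_n=\mathrm{diag}\big(\frac1{f_1-\alpha_n},\dots,\frac1{f_\ell-\alpha_n}\big)$, and let $Z$ (with indices) denote uniform noise that is the same for all databases. Database $n$ stores * for each subpacket $s$: the $\ell$ symbols $\frac{W_k^{[s]}}{f_k-\alpha_n}+\sum_{j=0}^{d}\alpha_n^jZ_{k,j}^{[s]}$ in the uncoded cases ($d=\ell$ in case 1, $d=\ell+1$ in case 3), or the single symbol $\sum_{k=1}^\ell\frac{W_k^{[s]}}{\alpha_n^k}+\sum_{j=0}^{d}\alpha_n^jZ_j^{[s]}$ in the coded cases ($d=\ell$ in case 2, $d=2\ell$ in case 4); * for each segment $i$, with a uniformly random permutation of its $P/B$ subpackets and its permutation reversing matrix $R^{[i]}$: the matrix $R_n^{[i]}=R^{[i]}\otimes\Gamma_n+Z^{[i]}$ (uncoded) or $R_n^{[i]}=R^{[i]}+\alpha_n^\ell Z^{[i]}$ (coded); * in cases 3 and 4, for a uniformly random permutation of the segments with reversing matrix $\hat R$: the matrix $\hat R_n=\hat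 R\otimes I_\ell+(I_B\otimes\Gamma_n^{-1})\hat Z$ (case 3) or $\hat R_n=\hat R+\alpha_n^\ell\hat Z$ (case 4). The users know the permutations. For each requested permuted index, database $n$ answers with one symbol: the inner product of its stored data with the column (coded cases) or the sum of the $\ell$ columns, rescaled by $\Gamma_n^{-1}$ (uncoded cases), of its reversing matrix at that index; in cases 3 and 4 this is the block diagonal matrix of the $R_n^{[i]}$ times the block matrix with blocks $I_{P/B}\otimes(\hat R_n)_{i,j}$ (case 3) or times $\hat R_n\otimes I_{P/B}$ (case 4). For each updated subpacket the user sends to database $n$ its permuted index and the symbol $\sum_{k}\prod_{j\ne k}\frac{f_j-\alpha_n}{f_j-f_k}\Delta_k+\prod_j(f_j-\alpha_n)Z$ (uncoded) or $\sum_k\frac{\Delta_k}{\alpha_n^k}+Z$ (coded), with fresh uniform $Z$; the $Pr$ tuples are listed in the order of the permuted indices. Each database places the symbols in a vector at their permuted indices (repeating each $\ell$ times in the uncoded cases), multiplies it by its reversing matrix and adds the result to its stored data. The subpacketization is given by $N=2\ell+2$, $N=3\ell+1$, $N=2\ell+4$, $N=5\ell+1$ in cases 1, 2, 3, 4. **Theorem.**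 The four schemes have the following costs, where the constants in $O(\cdot)$ are absolute, and leakages. | case | storage, permutations | reading cost | writing cost | storage complexity | leakage on $X$ | |---|---|---|---|---|---| | 1 | uncoded, within segments | $\frac{2r'(1+\frac{\log_q P}{N})}{1-\frac2N}$ | $\frac{2r(1+\log_q P)}{1-\frac2N}$ | $O(\frac{L^2}{B})$ | $H(\hat X_1,\dots,\hat X_B)$ | | 2 | MDS coded, within segments | $\frac{3r'(1+\frac{\log_q P}{N})}{1-\frac1N}$ | $\frac{3r(1+\log_q P)}{1-\frac1N}$ | $O(\frac{L^2}{BN^2})$ | $H(\hat X_1,\dots,\hat X_B)$ | | 3 | uncoded, within and inter-segment | $\frac{2r'(1+\frac{\log_q P}{N})}{1-\frac4N}$ | $\frac{2r(1+\log_q P)}{1-\frac4N}$ | $\max\{O(\frac{L^2}{B}),O(N^2B^2)\}$ | $H(\tilde X_1,\dots,\tilde X_B)$ | | 4 | MDS coded, within and inter-segment | $\frac{5r'(1+\frac{\log_q P}{N})}{1-\frac1N}$ | $\frac{5r(1+\log_q P)}{1-\frac1N}$ | $\max\{O(\frac{L^2}{N^2B}),O(B^2)\}$ | $H(\tilde X_1,\dots,\tilde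 X_B)$ | Moreover, in all four cases, with $G_n$ everything the user sends to database $n$ and $S_n$ the content of database $n$ (data and reversing matrices): * Reading correctness: the chosen subpackets are decoded without error from the $N$ answers. * Writing correctness: after the round the databases store, in the same form and with the same permutations, the model in which the $Pr$ subpackets in $X$ are increased by their updates and all others are unchanged. * Security: $I(W;S_n)=0$ for every $n$, both before the round and after it (with the updated model and storage). * Privacy of the values: $I(\Delta;(S_n,G_n)\mid X)=0$ for every $n$, where $S_n$ is taken before the writing phase; and every function $\varphi(\Delta)$ of the update values that is independent of $X$, such as a single value $\Delta_i$, satisfies $I(\varphi(\Delta);G_n)=0$. * Leakage about the positions: $I(X;G_n)=I(X;(S_n,G_n))$, with $S_n$ before the writing phase, equals the entropy in the last column, for every $n$. -/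

import Mathlib

universe u

namespace PRUW

/-! ### Shannon quantities of discrete random variables

A random variable is a function on a discrete probability space `(Ω, p)`.  In every use below the
sample space is finite, so that the sums are finite.  Entropies are measured in nats. -/

/-- Shannon entropy `H(X)`. -/
noncomputable def entropy {Ω α : Type*} (p : PMF Ω) (X : Ω → α) : ℝ :=
  ∑' a, Real.negMulLog ((p.map X) a).toReal

/-- Mutual information `I(X; Y) = H(X) + H(Y) - H(X, Y)`. -/
noncomputable def mutualInfo {Ω α β : Type*} (p : PMF Ω) (X : Ω → α) (Y : Ω → β) : ℝ :=
  entropy p X + entropy p Y - entropy p (fun ω => (X ω, Y ω))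

/-- Conditional mutual information `I(X; Y | Z) = H(X, Z) + H(Y, Z) - H(X, Y, Z) - H(Z)`. -/
noncomputable def condMutualInfo {Ω α β γ : Type*} (p : PMF Ω) (X : Ω → α) (Y : Ω → β)
    (Z : Ω → γ) : ℝ :=
  entropy p (fun ω => (X ω, Z ω)) + entropy p (fun ω => (Y ω, Z ω))
    - entropy p (fun ω => (X ω, Y ω, Z ω)) - entropy p Z

/-! ### The model, the sparse updates and their positions

There are `B` segments of `m` subpackets (`P = B * m`), and `ℓ` parameters per subpacket
(`L = P * ℓ`). -/

/-- Index of a subpacket: (segment, subpacket within the segment). -/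
abbrev Sub (B m : ℕ) : Type := Fin B × Fin m

/-- Values of all parameters of the model. -/
abbrev Model (F : Type u) (B m ℓ : ℕ) : Type u := Sub B m → Fin ℓ → F

/-- The possible sets of indices of `K` sparse subpackets. -/
abbrev Positions (B m K : ℕ) : Type := {x : Finset (Sub B m) // x.card = K}

/-- The values of the sparse updates: `ℓ` values for each of the `K` chosen subpackets. -/
abbrev Values (F : Type u) (ℓ K : ℕ) : Type u := Fin K → Fin ℓ → F

/-- The `i`-th element of a set of subpacket indices, in the order of the linear index
`segment * m + subpacket`. -/
def Positions.nth {B m K : ℕ} (x : Positions B m K) (i : Fin K) : Sub B m :=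
  finProdFinEquiv.symm
    ((x.1.map finProdFinEquiv.toEmbedding).orderEmbOfFin
      ((Finset.card_map _).trans x.2) i)

/-- The set of permuted indices of the subpackets in `x`, where `σ` sends each permuted index to
the real index. -/
def Positions.permuted {B m K : ℕ} (σ : Equiv.Perm (Sub B m)) (x : Positions B m K) :
    Positions B m K :=
  ⟨x.1.map σ.symm.toEmbedding, (Finset.card_map _).trans x.2⟩

/-- The sparse update of the whole model: the `i`-th subpacket of `x` is changed by `δ i`, and the
subpackets outside `x` are not changed. -/
def sparseUpdate {F : Type u} [Field F] {B m ℓ K : ℕ} (x : Positions B m K) (δ : Values F ℓ K) :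
    Model F B m ℓ :=
  fun s k => ∑ i : Fin K, if x.nth i = s then δ i k else 0

/-- `(X̂₁, …, X̂_B)`: the numbers of sparse subpackets in the segments. -/
def segCounts {B m K : ℕ} (x : Positions B m K) : Fin B → ℕ :=
  fun j => (x.1.filter (fun s => s.1 = j)).card

/-- `(X̃₁, …, X̃_B)`: the numbers of sparse subpackets in the segments, irrespective of the order
of the segments. -/
def unorderedCounts {B m K : ℕ} (x : Positions B m K) : Multiset ℕ :=
  Finset.univ.val.map (segCounts x)

/-! ### Schemes for one round of read-update-write, and what is required of them -/

/-- A scheme for a single user and a single round.  `Ku` is the number of subpackets that are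
updated (uplink), `Kd` the number of subpackets that are downloaded (downlink).

A coordinator draws a uniform key, shared with the users but not with the databases, and uniform
noise, and fills the databases.  In the reading phase the databases choose `Kd` permuted indices,
one designated database sends these indices to the user, and each database sends an answer that it
computes from its own content.  In the writing phase the user uploads a message to each database,
using the key and uniform noise of its own, and each database updates its own content. -/
structure Scheme (F : Type u) (N B m ℓ Ku Kd : ℕ) where
  /-- what the coordinator shares with the users -/
  Key : Type
  /-- noise of the coordinator -/
  Noise : Type u
  /-- noise of the user -/
  UserNoise : Type u
  /-- content of one database -/
  Store : Type u
  /-- answer of one database in the reading phase -/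
  Answer : Type u
  /-- message from the user to one database in the writing phase -/
  Upload : Type u
  [keyFintype : Fintype Key]
  [keyNonempty : Nonempty Key]
  [noiseFintype : Fintype Noise]
  [noiseNonempty : Nonempty Noise]
  [userNoiseFintype : Fintype UserNoise]
  [userNoiseNonempty : Nonempty UserNoise]
  [storeFintype : Fintype Store]
  [answerFintype : Fintype Answer]
  [uploadFintype : Fintype Upload]
  /-- the real index behind each permuted index -/
  realIdx : Key → Equiv.Perm (Sub B m)
  /-- content placed in database `n` -/
  store : Fin N → Model F B m ℓ → Key → Noise → Store
  /-- answer of database `n`, given the chosen permuted indices -/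
  answer : Fin N → Store → (Fin Kd → Sub B m) → Answer
  /-- message to database `n` -/
  upload : Fin N → Key → UserNoise → Positions B m Ku → Values F ℓ Ku → Upload
  /-- content of database `n` after the writing phase -/
  update : Fin N → Store → Upload → Store

attribute [instance] Scheme.keyFintype Scheme.keyNonempty Scheme.noiseFintype
  Scheme.noiseNonempty Scheme.userNoiseFintype Scheme.userNoiseNonempty Scheme.storeFintype
  Scheme.answerFintype Scheme.uploadFintype

/-- The data of a round: the model `W` before the round, the set `X` of positions of the sparse
updates, and the values of the sparse updates. -/
abbrev Data (F : Type u) (B m ℓ Ku : ℕ) : Type u :=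
  Model F B m ℓ × Positions B m Ku × Values F ℓ Ku

namespace Scheme

/-- Sample space of a round: data, key, noise of the coordinator, noise of the user. -/
abbrev Sample {F : Type u} {N B m ℓ Ku Kd : ℕ} (S : Scheme F N B m ℓ Ku Kd) : Type u :=
  Data F B m ℓ Ku × S.Key × S.Noise × S.UserNoise

/-- Law of a round: the data have an arbitrary joint law `p`; the key and the noises are uniform,
mutually independent, and independent of the data. -/
noncomputable def law {F : Type u} {N B m ℓ Ku Kd : ℕ} (S : Scheme F N B m ℓ Ku Kd)
    (p : PMF (Data F B m ℓ Ku)) : PMF S.Sample :=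
  p.bind fun d =>
    (PMF.uniformOfFintype (S.Key × S.Noise × S.UserNoise)).map fun ρ => (d, ρ)

/-- `W` before the round. -/
def modelBefore {F : Type u} {N B m ℓ Ku Kd : ℕ} (S : Scheme F N B m ℓ Ku Kd) (ω : S.Sample) :
    Model F B m ℓ := ω.1.1

/-- `X`, the positions of the sparse updates. -/
def positions {F : Type u} {N B m ℓ Ku Kd : ℕ} (S : Scheme F N B m ℓ Ku Kd) (ω : S.Sample) :
    Positions B m Ku := ω.1.2.1

/-- The values of the sparse updates. -/
def values {F : Type u} {N B m ℓ Ku Kd : ℕ} (S : Scheme F N B m ℓ Ku Kd) (ω : S.Sample) :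
    Values F ℓ Ku := ω.1.2.2

/-- `W` after the round. -/
def modelAfter {F : Type u} [Field F] {N B m ℓ Ku Kd : ℕ} (S : Scheme F N B m ℓ Ku Kd)
    (ω : S.Sample) : Model F B m ℓ :=
  S.modelBefore ω + sparseUpdate (S.positions ω) (S.values ω)

/-- Content of database `n` before the writing phase. -/
def storeBefore {F : Type u} {N B m ℓ Ku Kd : ℕ} (S : Scheme F N B m ℓ Ku Kd) (n : Fin N)
    (ω : S.Sample) : S.Store :=
  S.store n (S.modelBefore ω) ω.2.1 ω.2.2.1

/-- `G_n`, everything that the user sends to database `n`. -/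
def sent {F : Type u} {N B m ℓ Ku Kd : ℕ} (S : Scheme F N B m ℓ Ku Kd) (n : Fin N)
    (ω : S.Sample) : S.Upload :=
  S.upload n ω.2.1 ω.2.2.2 (S.positions ω) (S.values ω)

/-- Content of database `n` after the writing phase. -/
def storeAfter {F : Type u} {N B m ℓ Ku Kd : ℕ} (S : Scheme F N B m ℓ Ku Kd) (n : Fin N)
    (ω : S.Sample) : S.Store :=
  S.update n (S.storeBefore n ω) (S.sent n ω)

/-- Correctness in the reading phase: whatever permuted indices the databases choose, the
subpackets with these indices can be decoded without error from the `N` answers. -/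
def ReadCorrect {F : Type u} {N B m ℓ Ku Kd : ℕ} (S : Scheme F N B m ℓ Ku Kd) : Prop :=
  ∃ dec : (Fin Kd → Sub B m) → (Fin N → S.Answer) → Fin Kd → Fin ℓ → F,
    ∀ (w : Model F B m ℓ) (k : S.Key) (z : S.Noise) (V : Fin Kd → Sub B m),
      dec V (fun n => S.answer n (S.store n w k z) V) = fun i => w (S.realIdx k (V i))

/-- Correctness in the writing phase: after the round the databases store, in the form of the
initial storage with the same key, the model `W + Δ`. -/
def WriteCorrect {F : Type u} [Field F] {N B m ℓ Ku Kd : ℕ} (S : Scheme F N B m ℓ Ku Kd) : Prop :=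
  ∀ (w : Model F B m ℓ) (k : S.Key) (z : S.Noise) (u : S.UserNoise) (x : Positions B m Ku)
    (δ : Values F ℓ Ku), ∃ z₁ : S.Noise, ∀ n : Fin N,
      S.update n (S.store n w k z) (S.upload n k u x δ) = S.store n (w + sparseUpdate x δ) k z₁

/-- Security of the model: the content of each database, before and after the round, carries no
information about the model stored at that time. -/
def Secure {F : Type u} [Field F] {N B m ℓ Ku Kd : ℕ} (S : Scheme F N B m ℓ Ku Kd) : Prop :=
  ∀ (p : PMF (Data F B m ℓ Ku)) (n : Fin N),
    mutualInfo (S.law p) S.modelBefore (S.storeBefore n) = 0 ∧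
    mutualInfo (S.law p) S.modelAfter (S.storeAfter n) = 0

/-- Privacy of the values of the sparse updates: given the positions, what database `n` stores
and receives carries no information about the values; and what the user sends to database `n`
carries no information about any function of the values (one value, the values of one subpacket,
all of them) that is independent of the positions. -/
def ValuesPrivate {F : Type u} {N B m ℓ Ku Kd : ℕ} (S : Scheme F N B m ℓ Ku Kd) : Prop :=
  ∀ (p : PMF (Data F B m ℓ Ku)) (n : Fin N),
    condMutualInfo (S.law p) S.values (fun ω => (S.storeBefore n ω, S.sent n ω)) S.positions = 0 ∧
    ∀ (T : Type u) (φ : Values F ℓ Ku → T),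
      mutualInfo (S.law p) (fun ω => φ (S.values ω)) S.positions = 0 →
      mutualInfo (S.law p) (fun ω => φ (S.values ω)) (S.sent n) = 0

/-- The information leaked to each database about the positions of the sparse updates is exactly
the entropy of `stat X`; this holds for what the user sends, and also for what the user sends
together with the content of the database. -/
def PositionLeakage {F : Type u} {N B m ℓ Ku Kd : ℕ} (S : Scheme F N B m ℓ Ku Kd) {T : Type*}
    (stat : Positions B m Ku → T) : Prop :=
  ∀ (p : PMF (Data F B m ℓ Ku)) (n : Fin N),
    mutualInfo (S.law p) S.positions (S.sent n) =
      entropy (S.law p) (fun ω => stat (S.positions ω)) ∧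
    mutualInfo (S.law p) S.positions (fun ω => (S.storeBefore n ω, S.sent n ω)) =
      entropy (S.law p) (fun ω => stat (S.positions ω))

/-- Number of `q`-ary symbols needed for an element of a finite type `A`. -/
noncomputable def symbols (F A : Type*) [Fintype F] [Fintype A] : ℝ :=
  Real.logb (Fintype.card F) (Fintype.card A)

/-- Reading cost: the symbols downloaded (one answer per database, and the permuted indices from
one designated database) over the size of the model. -/
noncomputable def readingCost {F : Type u} [Fintype F] {N B m ℓ Ku Kd : ℕ}
    (S : Scheme F N B m ℓ Ku Kd) : ℝ :=
  ((∑ _n : Fin N, symbols F S.Answer) + symbols F (Fin Kd → Sub B m)) / ((B * m * ℓ : ℕ) : ℝ)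

/-- Writing cost: the symbols uploaded to all databases over the size of the model. -/
noncomputable def writingCost {F : Type u} [Fintype F] {N B m ℓ Ku Kd : ℕ}
    (S : Scheme F N B m ℓ Ku Kd) : ℝ :=
  (∑ _n : Fin N, symbols F S.Upload) / ((B * m * ℓ : ℕ) : ℝ)

/-- Number of symbols stored in each database. -/
noncomputable def storageSize {F : Type u} [Fintype F] {N B m ℓ Ku Kd : ℕ}
    (S : Scheme F N B m ℓ Ku Kd) : ℝ :=
  symbols F S.Store

/-- The scheme is correct and secure, keeps the values of the updates private, leaks `H(stat X)`
about the positions, and has reading cost `CR` and writing cost `CW`. -/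
structure Achieves {F : Type u} [Field F] [Fintype F] {N B m ℓ Ku Kd : ℕ}
    (S : Scheme F N B m ℓ Ku Kd) {T : Type*} (stat : Positions B m Ku → T) (CR CW : ℝ) : Prop where
  readCorrect : S.ReadCorrect
  writeCorrect : S.WriteCorrect
  secure : S.Secure
  valuesPrivate : S.ValuesPrivate
  positionLeakage : S.PositionLeakage stat
  readingCost_eq : S.readingCost = CR
  writingCost_eq : S.writingCost = CW

end Scheme

/-! ### Building blocks of the four schemes -/

/-- Permutation reversing matrix: column `b` has its `1` in row `σ b`. -/
def permRev (F : Type u) [Field F] {a : ℕ} (σ : Equiv.Perm (Fin a)) : Matrix (Fin a) (Fin a) F :=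
  Matrix.of fun i j => if i = σ j then 1 else 0

/-- Within-segment permutations: permuted subpacket `t` of segment `j` is the real subpacket
`π j t` of segment `j`. -/
def withinIdx {B m : ℕ} (π : Fin B → Equiv.Perm (Fin m)) : Equiv.Perm (Sub B m) :=
  Equiv.prodShear (Equiv.refl _) π

/-- Within- and inter-segment permutations: the permuted pair `(φ, η)` is the real pair
`(σ φ, π (σ φ) η)`. -/
def twoStageIdx {B m : ℕ} (π : Fin B → Equiv.Perm (Fin m)) (σ : Equiv.Perm (Fin B)) :
    Equiv.Perm (Sub B m) :=
  Equiv.prodShear σ fun φ => π (σ φ)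

/-- A message of `K` (update, permuted index) tuples.  The tuples are listed by increasing
permuted index, so that their order carries no further information. -/
abbrev Tuples (F : Type u) (B m K : ℕ) : Type u := Fin K → F × Sub B m

/-- The user's message: `comb` combines the updates of one subpacket with one noise symbol. -/
def tuples {F : Type u} [Field F] {B m ℓ K : ℕ} (comb : (Fin ℓ → F) → F → F)
    (σ : Equiv.Perm (Sub B m)) (u : Fin K → F) (x : Positions B m K) (δ : Values F ℓ K) :
    Tuples F B m K :=
  fun i =>
    (comb (sparseUpdate x δ (σ ((x.permuted σ).nth i))) (u i), (x.permuted σ).nth i)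

/-- Permuted update vector built by a database from the tuples that it receives. -/
def updateVector {F : Type u} [Field F] {B m K : ℕ} (G : Tuples F B m K) : Sub B m → F :=
  fun s => ∑ i : Fin K, if (G i).2 = s then (G i).1 else 0

/-- Uncoded storage of one parameter: `w / (f - a) + ∑ⱼ aʲ zⱼ`. -/
def uncodedSymbol {F : Type u} [Field F] {d : ℕ} (f a w : F) (z : Fin d → F) : F :=
  (f - a)⁻¹ * w + ∑ j : Fin d, a ^ (j : ℕ) * z j

/-- MDS coded storage of one subpacket: `∑ᵢ wᵢ / aⁱ + ∑ⱼ aʲ zⱼ`, with `i = 1, …, ℓ`. -/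
def codedSymbol {F : Type u} [Field F] {ℓ d : ℕ} (a : F) (w : Fin ℓ → F) (z : Fin d → F) : F :=
  (∑ i : Fin ℓ, (a ^ ((i : ℕ) + 1))⁻¹ * w i) + ∑ j : Fin d, a ^ (j : ℕ) * z j

/-- Combined update for uncoded storage. -/
def uncodedComb {F : Type u} [Field F] {ℓ : ℕ} (f : Fin ℓ → F) (a : F) (δ : Fin ℓ → F) (z : F) :
    F :=
  (∑ k : Fin ℓ, (∏ j ∈ Finset.univ.erase k, (f j - a)) *
      (δ k / ∏ j ∈ Finset.univ.erase k, (f j - f k)))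
    + (∏ j : Fin ℓ, (f j - a)) * z

/-- Combined update for MDS coded storage. -/
def codedComb {F : Type u} [Field F] {ℓ : ℕ} (a : F) (δ : Fin ℓ → F) (z : F) : F :=
  (∑ k : Fin ℓ, (a ^ ((k : ℕ) + 1))⁻¹ * δ k) + z

/-- Noisy within-segment permutation reversing matrix `(R ⊗ Γ) + Z`, where `Γ` is the diagonal
matrix with entries `1 / (f k - a)`. -/
def uncodedRev {F : Type u} [Field F] {m ℓ : ℕ} (f : Fin ℓ → F) (a : F) (π : Equiv.Perm (Fin m))
    (Z : Matrix (Fin m × Fin ℓ) (Fin m × Fin ℓ) F) : Matrix (Fin m × Fin ℓ) (Fin m × Fin ℓ) F :=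
  Matrix.kroneckerMap (· * ·) (permRev F π) (Matrix.diagonal fun k => (f k - a)⁻¹) + Z

/-- Noisy inter-segment permutation reversing matrix `(R ⊗ I) + (I ⊗ Γ⁻¹) Z`. -/
def uncodedInterRev {F : Type u} [Field F] {B ℓ : ℕ} (f : Fin ℓ → F) (a : F)
    (σ : Equiv.Perm (Fin B)) (Z : Matrix (Fin B × Fin ℓ) (Fin B × Fin ℓ) F) :
    Matrix (Fin B × Fin ℓ) (Fin B × Fin ℓ) F :=
  Matrix.kroneckerMap (· * ·) (permRev F σ) (1 : Matrix (Fin ℓ) (Fin ℓ) F)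
    + Matrix.kroneckerMap (· * ·) (1 : Matrix (Fin B) (Fin B) F)
        (Matrix.diagonal fun k => f k - a) * Z

/-- Noisy permutation reversing matrix `R + a ^ ℓ Z` for coded storage. -/
def codedRev {F : Type u} [Field F] {b : ℕ} (ℓ : ℕ) (a : F) (π : Equiv.Perm (Fin b))
    (Z : Matrix (Fin b) (Fin b) F) : Matrix (Fin b) (Fin b) F :=
  permRev F π + a ^ ℓ • Z

/-- Combined matrix for uncoded storage: the block diagonal matrix of the `R i` times the matrix
whose `(i, j)` block is `I ⊗ b i j`, where `b i j` is the `(i, j)` block of size `ℓ × ℓ` of `H`. -/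
def uncodedCombined {F : Type u} [Field F] {B m ℓ : ℕ}
    (R : Fin B → Matrix (Fin m × Fin ℓ) (Fin m × Fin ℓ) F)
    (H : Matrix (Fin B × Fin ℓ) (Fin B × Fin ℓ) F) :
    Matrix (Sub B m × Fin ℓ) (Sub B m × Fin ℓ) F :=
  Matrix.of fun a b => ∑ h : Fin ℓ, R a.1.1 (a.1.2, a.2) (b.1.2, h) * H (a.1.1, h) (b.1.1, b.2)

/-- Combined matrix for coded storage: the block diagonal matrix of the `R i` times `H ⊗ I`. -/
def codedCombined {F : Type u} [Field F] {B m : ℕ} (R : Fin B → Matrix (Fin m) (Fin m) F)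
    (H : Matrix (Fin B) (Fin B) F) : Matrix (Sub B m) (Sub B m) F :=
  Matrix.of fun a b => R a.1 a.2 b.2 * H a.1 b.1

/-! ### The four schemes -/

/-- Case 1: uncoded storage, within-segment permutations. -/
def scheme1 {F : Type u} [Field F] [Fintype F] {N ℓ : ℕ} (f : Fin ℓ → F) (α : Fin N → F)
    (B m Ku Kd : ℕ) : Scheme F N B m ℓ Ku Kd where
  Key := Fin B → Equiv.Perm (Fin m)
  Noise := (Sub B m → Fin ℓ → Fin (ℓ + 1) → F) ×
    (Fin B → Matrix (Fin m × Fin ℓ) (Fin m × Fin ℓ) F)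
  UserNoise := Fin Ku → F
  Store := (Sub B m → Fin ℓ → F) × (Fin B → Matrix (Fin m × Fin ℓ) (Fin m × Fin ℓ) F)
  Answer := Fin Kd → F
  Upload := Tuples F B m Ku
  realIdx := withinIdx
  store n w π z :=
    (fun s k => uncodedSymbol (f k) (α n) (w s k) (z.1 s k),
     fun j => uncodedRev f (α n) (π j) (z.2 j))
  answer n S V i :=
    -- the query is the sum of the `ℓ` columns that belong to the permuted index
    ∑ s : Fin m, ∑ k : Fin ℓ, ((f k - α n) * S.1 ((V i).1, s) k) *
      ∑ h : Fin ℓ, S.2 (V i).1 (s, k) ((V i).2, h)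
  upload n π u x δ := tuples (uncodedComb f (α n)) (withinIdx π) u x δ
  update _ S G :=
    (fun s k => S.1 s k +
      (S.2 s.1).mulVec (fun b : Fin m × Fin ℓ => updateVector G (s.1, b.1)) (s.2, k),
     S.2)

/-- Case 2: MDS coded storage, within-segment permutations. -/
def scheme2 {F : Type u} [Field F] [Fintype F] {N : ℕ} (α : Fin N → F)
    (B m ℓ Ku Kd : ℕ) : Scheme F N B m ℓ Ku Kd where
  Key := Fin B → Equiv.Perm (Fin m)
  Noise := (Sub B m → Fin (ℓ + 1) → F) × (Fin B → Matrix (Fin m) (Fin m) F)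
  UserNoise := Fin Ku → F
  Store := (Sub B m → F) × (Fin B → Matrix (Fin m) (Fin m) F)
  Answer := Fin Kd → F
  Upload := Tuples F B m Ku
  realIdx := withinIdx
  store n w π z :=
    (fun s => codedSymbol (α n) (w s) (z.1 s),
     fun j => codedRev ℓ (α n) (π j) (z.2 j))
  answer _ S V i := ∑ s : Fin m, S.1 ((V i).1, s) * S.2 (V i).1 s (V i).2
  upload n π u x δ := tuples (codedComb (α n)) (withinIdx π) u x δ
  update _ S G :=
    (fun s => S.1 s + (S.2 s.1).mulVec (fun t : Fin m => updateVector G (s.1, t)) s.2,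
     S.2)

/-- Case 3: uncoded storage, within- and inter-segment permutations. -/
def scheme3 {F : Type u} [Field F] [Fintype F] {N ℓ : ℕ} (f : Fin ℓ → F) (α : Fin N → F)
    (B m Ku Kd : ℕ) : Scheme F N B m ℓ Ku Kd where
  Key := (Fin B → Equiv.Perm (Fin m)) × Equiv.Perm (Fin B)
  Noise := (Sub B m → Fin ℓ → Fin (ℓ + 2) → F) ×
    (Fin B → Matrix (Fin m × Fin ℓ) (Fin m × Fin ℓ) F) ×
    Matrix (Fin B × Fin ℓ) (Fin B × Fin ℓ) F
  UserNoise := Fin Ku → F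
  Store := (Sub B m → Fin ℓ → F) × (Fin B → Matrix (Fin m × Fin ℓ) (Fin m × Fin ℓ) F) ×
    Matrix (Fin B × Fin ℓ) (Fin B × Fin ℓ) F
  Answer := Fin Kd → F
  Upload := Tuples F B m Ku
  realIdx κ := twoStageIdx κ.1 κ.2
  store n w κ z :=
    (fun s k => uncodedSymbol (f k) (α n) (w s k) (z.1 s k),
     fun j => uncodedRev f (α n) (κ.1 j) (z.2.1 j),
     uncodedInterRev f (α n) κ.2 z.2.2)
  answer n S V i :=
    -- the query is `I ⊗ Γ⁻¹` times the sum of the `ℓ` columns of the permuted index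
    ∑ s : Sub B m, ∑ k : Fin ℓ, S.1 s k *
      ((f k - α n) * ∑ h : Fin ℓ, uncodedCombined S.2.1 S.2.2 (s, k) (V i, h))
  upload n κ u x δ := tuples (uncodedComb f (α n)) (twoStageIdx κ.1 κ.2) u x δ
  update _ S G :=
    (fun s k => S.1 s k +
      (uncodedCombined S.2.1 S.2.2).mulVec
        (fun b : Sub B m × Fin ℓ => updateVector G b.1) (s, k),
     S.2)

/-- Case 4: MDS coded storage, within- and inter-segment permutations. -/
def scheme4 {F : Type u} [Field F] [Fintype F] {N : ℕ} (α : Fin N → F)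
    (B m ℓ Ku Kd : ℕ) : Scheme F N B m ℓ Ku Kd where
  Key := (Fin B → Equiv.Perm (Fin m)) × Equiv.Perm (Fin B)
  Noise := (Sub B m → Fin (2 * ℓ + 1) → F) × (Fin B → Matrix (Fin m) (Fin m) F) ×
    Matrix (Fin B) (Fin B) F
  UserNoise := Fin Ku → F
  Store := (Sub B m → F) × (Fin B → Matrix (Fin m) (Fin m) F) × Matrix (Fin B) (Fin B) F
  Answer := Fin Kd → F
  Upload := Tuples F B m Ku
  realIdx κ := twoStageIdx κ.1 κ.2
  store n w κ z :=
    (fun s => codedSymbol (α n) (w s) (z.1 s),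
     fun j => codedRev ℓ (α n) (κ.1 j) (z.2.1 j),
     codedRev ℓ (α n) κ.2 z.2.2)
  answer _ S V i := ∑ s : Sub B m, S.1 s * codedCombined S.2.1 S.2.2 s (V i)
  upload n κ u x δ := tuples (codedComb (α n)) (twoStageIdx κ.1 κ.2) u x δ
  update _ S G :=
    (fun s => S.1 s + (codedCombined S.2.1 S.2.2).mulVec (updateVector G) s,
     S.2)

end PRUW

/-!
Viewed as functions of the evaluation point `α n`, the parameters sit in poles, simple ones at the
`f k` or one of order `ℓ` at `0`, and all noise is polynomial in `α n` of low degree.  Multiplying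
by a noisy permutation reversing matrix moves each pole to its real index and otherwise only adds
polynomials of low degree.  The `N` answers determine the polar part, because `N` exceeds the number
of poles plus the degree; an update is turned into the increment of the stored data by the same
computation.

At a single database the polynomial noise is a one-time pad: a change of the model, of the
permutations or of the update values is undone by a bijection of the uniform randomness, so that it
does not change the law of what the database sees.  The only visible data are the permuted
positions.  Permutations inside the segments carry one set of positions to another exactly when
their segment counts agree, and with permutations of the segments exactly when the counts agree up
to order; hence the leakage is the entropy of the counts.
-/

namespace PRUW

section Probability

variable {Ω α β γ δ : Type*}

/-- The probability `P(X = a)` as a real number. -/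
noncomputable def prob (p : PMF Ω) (X : Ω → α) (a : α) : ℝ :=
  ((p.map X) a).toReal

theorem prob_nonneg (p : PMF Ω) (X : Ω → α) (a : α) : 0 ≤ prob p X a :=
  ENNReal.toReal_nonneg

theorem prob_const (p : PMF Ω) (c : α) : prob p (fun _ => c) c = 1 := by
  have h : p.map (fun _ => c) = PMF.pure c := p.map_const c
  rw [prob, h, PMF.pure_apply_self, ENNReal.toReal_one]

theorem prob_map (p : PMF Ω) (f : Ω → β) (X : β → α) (a : α) :
    prob (p.map f) X a = prob p (X ∘ f) a := by
  rw [prob, PMF.map_comp, prob]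

theorem prob_eq_zero_of_forall_ne (p : PMF Ω) (X : Ω → α) {a : α} (h : ∀ ω, X ω ≠ a) :
    prob p X a = 0 := by
  have ha : (p.map X) a = 0 := by
    rw [PMF.apply_eq_zero_iff, PMF.support_map]
    rintro ⟨ω, -, hω⟩
    exact h ω hω
  rw [prob, ha, ENNReal.toReal_zero]

theorem prob_apply_pos (p : PMF Ω) (X : Ω → α) {ω : Ω} (h : (p ω).toReal ≠ 0) :
    0 < prob p X (X ω) := by
  have hω : X ω ∈ (p.map X).support :=
    (PMF.mem_support_map_iff X p _).2 ⟨ω, fun h0 => h (by rw [h0, ENNReal.toReal_zero]), rfl⟩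
  exact ENNReal.toReal_pos ((PMF.mem_support_iff _ _).1 hω) ((p.map X).apply_ne_top _)

theorem prob_eq_sum [Fintype Ω] [DecidableEq α] (p : PMF Ω) (X : Ω → α) (a : α) :
    prob p X a = ∑ ω with X ω = a, (p ω).toReal := by
  rw [prob, PMF.map_apply, tsum_fintype, ENNReal.toReal_sum, Finset.sum_filter]
  · exact Finset.sum_congr rfl fun ω _ => by split_ifs <;> simp_all
  · exact fun ω _ => by split_ifs <;> simp [p.apply_ne_top]

theorem sum_prob_mul [Fintype Ω] [DecidableEq α] (p : PMF Ω) (X : Ω → α) (g : α → ℝ) :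
    ∑ a ∈ Finset.univ.image X, prob p X a * g a = ∑ ω, (p ω).toReal * g (X ω) := by
  rw [← Finset.sum_fiberwise_of_maps_to
    (fun ω _ => Finset.mem_image_of_mem X (Finset.mem_univ ω)) (fun ω => (p ω).toReal * g (X ω))]
  refine Finset.sum_congr rfl fun a _ => ?_
  rw [prob_eq_sum, Finset.sum_mul]
  exact Finset.sum_congr rfl fun ω hω => by rw [(Finset.mem_filter.1 hω).2]

theorem sum_prob [Fintype Ω] [DecidableEq α] (p : PMF Ω) (X : Ω → α) :
    ∑ a ∈ Finset.univ.image X, prob p X a = 1 := by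
  have hp : ∑ ω, (p ω).toReal = 1 := by
    rw [← ENNReal.toReal_sum fun ω _ => p.apply_ne_top ω,
      ← tsum_fintype (L := .unconditional _), p.tsum_coe, ENNReal.toReal_one]
  simpa [hp] using sum_prob_mul p X fun _ => 1

theorem entropy_eq_sum [Fintype Ω] (p : PMF Ω) (X : Ω → α) :
    entropy p X = ∑ ω, (p ω).toReal * -Real.log (prob p X (X ω)) := by
  classical
  rw [← sum_prob_mul p X fun a => -Real.log (prob p X a), entropy,
    tsum_eq_sum (s := Finset.univ.image X)]
  · exact Finset.sum_congr rfl fun a _ => by rw [Real.negMulLog, ← prob, neg_mul, mul_neg]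
  · intro a ha
    have hX : ∀ ω, X ω ≠ a := by simpa using ha
    rw [← prob, prob_eq_zero_of_forall_ne p X hX, Real.negMulLog_zero]

theorem entropy_const [Finite Ω] (p : PMF Ω) (c : α) : entropy p (fun _ => c) = 0 := by
  cases nonempty_fintype Ω
  simp [entropy_eq_sum, prob_const]

theorem entropy_add_entropy_eq_of_prob_mul_eq [Finite Ω] (p : PMF Ω) (X : Ω → α) (Y : Ω → β)
    (U : Ω → γ) (V : Ω → δ)
    (h : ∀ ω, prob p X (X ω) * prob p Y (Y ω) = prob p U (U ω) * prob p V (V ω)) :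
    entropy p X + entropy p Y = entropy p U + entropy p V := by
  cases nonempty_fintype Ω
  simp only [entropy_eq_sum, ← Finset.sum_add_distrib, ← mul_add]
  refine Finset.sum_congr rfl fun ω _ => ?_
  by_cases h0 : (p ω).toReal = 0
  · rw [h0, zero_mul, zero_mul]
  have hlog := congrArg Real.log (h ω)
  rw [Real.log_mul (prob_apply_pos p X h0).ne' (prob_apply_pos p Y h0).ne',
    Real.log_mul (prob_apply_pos p U h0).ne' (prob_apply_pos p V h0).ne'] at hlog
  linear_combination -(p ω).toReal * hlog

theorem mutualInfo_eq_entropy_of_prob_mul_eq [Finite Ω] {p : PMF Ω} {X : Ω → α} {Y : Ω → β}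
    {T : Ω → γ}
    (h : ∀ ω, prob p X (X ω) * prob p Y (Y ω) =
      prob p (fun ω => (X ω, Y ω)) (X ω, Y ω) * prob p T (T ω)) :
    mutualInfo p X Y = entropy p T := by
  rw [mutualInfo, entropy_add_entropy_eq_of_prob_mul_eq p X Y (fun ω => (X ω, Y ω)) T h,
    add_sub_cancel_left]

theorem condMutualInfo_eq_zero_of_prob_mul_eq [Finite Ω] {p : PMF Ω} {X : Ω → α} {Y : Ω → β}
    {Z : Ω → γ}
    (h : ∀ ω, prob p (fun ω => (X ω, Z ω)) (X ω, Z ω) * prob p (fun ω => (Y ω, Z ω)) (Y ω, Z ω) =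
      prob p (fun ω => (X ω, Y ω, Z ω)) (X ω, Y ω, Z ω) * prob p Z (Z ω)) :
    condMutualInfo p X Y Z = 0 := by
  rw [condMutualInfo, entropy_add_entropy_eq_of_prob_mul_eq p (fun ω => (X ω, Z ω))
    (fun ω => (Y ω, Z ω)) (fun ω => (X ω, Y ω, Z ω)) Z h]
  ring

-- Gibbs' inequality is an equality only for equal weights: `t * klFun (P / t)` is nonnegative
-- and vanishes only for `P = t`, and its sum is the divergence.
theorem eq_of_sum_mul_log_div_eq_zero {ι : Type*} {s : Finset ι} {P t : ι → ℝ}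
    (hP : ∀ i ∈ s, 0 ≤ P i) (ht : ∀ i ∈ s, 0 ≤ t i) (habs : ∀ i ∈ s, t i = 0 → P i = 0)
    (hsum : ∑ i ∈ s, P i = ∑ i ∈ s, t i) (hlog : ∑ i ∈ s, P i * Real.log (P i / t i) = 0) :
    ∀ i ∈ s, P i = t i := by
  have hterm : ∀ i ∈ s, t i * InformationTheory.klFun (P i / t i) =
      P i * Real.log (P i / t i) + t i - P i := by
    intro i hi
    rcases eq_or_ne (t i) 0 with h0 | h0
    · simp [h0, habs i hi h0]
    · rw [InformationTheory.klFun]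
      field_simp
  have hzero : ∑ i ∈ s, t i * InformationTheory.klFun (P i / t i) = 0 := by
    rw [Finset.sum_congr rfl hterm, Finset.sum_sub_distrib, Finset.sum_add_distrib, hlog, hsum,
      zero_add, sub_self]
  intro i hi
  have hnonneg : ∀ i ∈ s, 0 ≤ P i / t i := fun i hi => div_nonneg (hP i hi) (ht i hi)
  have hi0 := (Finset.sum_eq_zero_iff_of_nonneg fun i hi =>
    mul_nonneg (ht i hi) (InformationTheory.klFun_nonneg (hnonneg i hi))).1 hzero i hi
  rcases mul_eq_zero.1 hi0 with h0 | h1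
  · rw [h0, habs i hi h0]
  · exact eq_of_div_eq_one ((InformationTheory.klFun_eq_zero_iff (hnonneg i hi)).1 h1)

theorem mutualInfo_eq_sum [Fintype Ω] (p : PMF Ω) (X : Ω → α) (Y : Ω → β) :
    mutualInfo p X Y = ∑ ω, (p ω).toReal *
      Real.log (prob p (fun ω => (X ω, Y ω)) (X ω, Y ω) / (prob p X (X ω) * prob p Y (Y ω))) := by
  simp only [mutualInfo, entropy_eq_sum, ← Finset.sum_add_distrib, ← Finset.sum_sub_distrib]
  refine Finset.sum_congr rfl fun ω _ => ?_
  by_cases h0 : (p ω).toReal = 0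
  · simp only [h0, zero_mul, add_zero, sub_zero]
  have hX := (prob_apply_pos p X h0).ne'
  have hY := (prob_apply_pos p Y h0).ne'
  rw [Real.log_div (prob_apply_pos p (fun ω => (X ω, Y ω)) h0).ne' (mul_ne_zero hX hY),
    Real.log_mul hX hY]
  ring

theorem prob_pair_eq_zero_of_prob_mul_eq_zero [Finite Ω] (p : PMF Ω) (X : Ω → α) (Y : Ω → β)
    {a : α} {b : β} (h : prob p X a * prob p Y b = 0) :
    prob p (fun ω => (X ω, Y ω)) (a, b) = 0 := by
  rw [prob, ENNReal.toReal_eq_zero_iff, or_iff_left (PMF.apply_ne_top _ _),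
    PMF.apply_eq_zero_iff, PMF.support_map]
  rintro ⟨ω, hω, hab⟩
  obtain ⟨rfl, rfl⟩ := Prod.ext_iff.1 hab
  have hpos : (p ω).toReal ≠ 0 := ENNReal.toReal_ne_zero.2 ⟨hω, p.apply_ne_top ω⟩
  exact (mul_pos (prob_apply_pos p X hpos) (prob_apply_pos p Y hpos)).ne' h

theorem prob_pair_of_mutualInfo_eq_zero [Finite Ω] {p : PMF Ω} {X : Ω → α} {Y : Ω → β}
    (h : mutualInfo p X Y = 0) (a : α) (b : β) :
    prob p (fun ω => (X ω, Y ω)) (a, b) = prob p X a * prob p Y b := by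
  classical
  cases nonempty_fintype Ω
  rcases eq_or_ne (prob p X a * prob p Y b) 0 with h0 | h0
  · rw [h0, prob_pair_eq_zero_of_prob_mul_eq_zero p X Y h0]
  set XY : Ω → α × β := fun ω => (X ω, Y ω)
  set s : Finset (α × β) := Finset.univ.image X ×ˢ Finset.univ.image Y with hs
  have hab : (a, b) ∈ s := by
    by_contra hab
    rcases not_and_or.1 (Finset.mem_product.not.1 hab) with hX | hY
    · exact h0 (by rw [prob_eq_zero_of_forall_ne p X (by simpa using hX), zero_mul])
    · exact h0 (by rw [prob_eq_zero_of_forall_ne p Y (by simpa using hY), mul_zero])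
  have hsub : Finset.univ.image XY ⊆ s :=
    Finset.image_subset_iff.2 fun ω _ => by simp [hs, XY]
  have hout : ∀ c ∈ s, c ∉ Finset.univ.image XY → prob p XY c = 0 := fun c _ hc =>
    prob_eq_zero_of_forall_ne p XY (by simpa using hc)
  refine eq_of_sum_mul_log_div_eq_zero (t := fun c => prob p X c.1 * prob p Y c.2)
    (fun c _ => prob_nonneg p XY c) (fun c _ => mul_nonneg (prob_nonneg _ _ _) (prob_nonneg _ _ _))
    (fun c _ hc => prob_pair_eq_zero_of_prob_mul_eq_zero p X Y hc) ?_ ?_ (a, b) hab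
  · rw [← Finset.sum_subset hsub hout, sum_prob, hs, Finset.sum_product]
    simp only [← Finset.mul_sum, sum_prob, mul_one]
  · rw [← Finset.sum_subset hsub fun c hc hc' => by rw [hout c hc hc', zero_mul],
      sum_prob_mul p XY fun c => Real.log (prob p XY c / (prob p X c.1 * prob p Y c.2)),
      ← mutualInfo_eq_sum, h]

theorem mutualInfo_eq_zero_iff [Finite Ω] {p : PMF Ω} {X : Ω → α} {Y : Ω → β} :
    mutualInfo p X Y = 0 ↔
      ∀ a b, prob p (fun ω => (X ω, Y ω)) (a, b) = prob p X a * prob p Y b := by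
  refine ⟨prob_pair_of_mutualInfo_eq_zero, fun h => ?_⟩
  rw [← entropy_const p ()]
  exact mutualInfo_eq_entropy_of_prob_mul_eq fun ω => by rw [h, prob_const, mul_one]

end Probability

section IndependentNoise

variable {D R α β γ τ : Type*}

/-- The joint law of data with law `p` and independent noise with law `ν`. -/
noncomputable def indepLaw (p : PMF D) (ν : PMF R) : PMF (D × R) :=
  p.bind fun d => ν.map fun ρ => (d, ρ)

/-- The conditional law of `Y` given the data, when the noise has law `ν`. -/
noncomputable def condLaw (ν : PMF R) (Y : D × R → β) (d : D) : PMF β :=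
  ν.map fun ρ => Y (d, ρ)

theorem map_indepLaw (p : PMF D) (ν : PMF R) (Y : D × R → β) :
    (indepLaw p ν).map Y = p.bind (condLaw ν Y) := by
  simp only [indepLaw, PMF.map_bind, PMF.map_comp, Function.comp_def]
  rfl

theorem map_fst_indepLaw (p : PMF D) (ν : PMF R) : (indepLaw p ν).map Prod.fst = p := by
  have h : condLaw ν (Prod.fst : D × R → D) = PMF.pure := funext fun d => ν.map_const d
  rw [map_indepLaw, h, PMF.bind_pure]

theorem prob_indepLaw_fst (p : PMF D) (ν : PMF R) (v : D → α) (a : α) :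
    prob (indepLaw p ν) (fun ω => v ω.1) a = prob p v a := by
  conv_rhs => rw [← map_fst_indepLaw p ν, prob_map, Function.comp_def]

theorem prob_indepLaw [Fintype D] (p : PMF D) (ν : PMF R) (Y : D × R → β) (y : β) :
    prob (indepLaw p ν) Y y = ∑ d, (p d).toReal * (condLaw ν Y d y).toReal := by
  rw [prob, map_indepLaw, PMF.bind_apply, tsum_fintype, ENNReal.toReal_sum fun d _ =>
    ENNReal.mul_ne_top (p.apply_ne_top d) ((condLaw ν Y d).apply_ne_top y)]
  simp only [ENNReal.toReal_mul]

theorem toReal_condLaw_of_iff [DecidableEq α] (ν : PMF R) {U : D × R → γ} {v : D → α}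
    {Y : D × R → β} {u : γ} {a : α} {y : β} (hU : ∀ ω, U ω = u ↔ v ω.1 = a ∧ Y ω = y) (d : D) :
    (condLaw ν U d u).toReal = if v d = a then (condLaw ν Y d y).toReal else 0 := by
  split_ifs with hd
  · have hiff (ρ : R) : u = U (d, ρ) ↔ y = Y (d, ρ) := by
      rw [eq_comm, hU, eq_comm (a := y), and_iff_right hd]
    rw [condLaw, condLaw, PMF.map_apply, PMF.map_apply]
    refine congrArg _ (tsum_congr fun ρ => ?_)
    congr 1
    exact propext (hiff ρ)
  · exact prob_eq_zero_of_forall_ne ν _ fun ρ hρ => hd ((hU _).1 hρ).1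

theorem prob_indepLaw_of_iff [Finite D] (p : PMF D) (ν : PMF R) {U : D × R → γ} {v : D → α}
    {Y : D × R → β} {u : γ} {a : α} {y : β} {d₀ : D}
    (hU : ∀ ω, U ω = u ↔ v ω.1 = a ∧ Y ω = y) (hY : ∀ d, v d = a → condLaw ν Y d = condLaw ν Y d₀) :
    prob (indepLaw p ν) U u = prob p v a * (condLaw ν Y d₀ y).toReal := by
  classical
  cases nonempty_fintype D
  rw [prob_indepLaw, prob_eq_sum, Finset.sum_filter, Finset.sum_mul]
  refine Finset.sum_congr rfl fun d _ => ?_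
  rw [toReal_condLaw_of_iff ν hU]
  split_ifs with hd
  · rw [hY d hd]
  · rw [mul_zero, zero_mul]

theorem mutualInfo_indepLaw_eq_entropy [Finite D] [Finite R] (p : PMF D) (ν : PMF R) (x : D → γ)
    (Y : D × R → β) (stat : γ → τ)
    (hY : ∀ d d', stat (x d) = stat (x d') → condLaw ν Y d = condLaw ν Y d')
    (hstat : ∀ ω ω', Y ω = Y ω' → stat (x ω.1) = stat (x ω'.1)) :
    mutualInfo (indepLaw p ν) (fun ω => x ω.1) Y =
      entropy (indepLaw p ν) (fun ω => stat (x ω.1)) := by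
  refine mutualInfo_eq_entropy_of_prob_mul_eq fun ω => ?_
  have hpair : prob (indepLaw p ν) (fun ω => (x ω.1, Y ω)) (x ω.1, Y ω) =
      prob p x (x ω.1) * (condLaw ν Y ω.1 (Y ω)).toReal :=
    prob_indepLaw_of_iff p ν (fun _ => Prod.ext_iff) fun d hd => hY d ω.1 (congrArg stat hd)
  have hsnd : prob (indepLaw p ν) Y (Y ω) =
      prob p (fun d => stat (x d)) (stat (x ω.1)) * (condLaw ν Y ω.1 (Y ω)).toReal :=
    prob_indepLaw_of_iff p ν (fun _ => ⟨fun h => ⟨hstat _ _ h, h⟩, And.right⟩)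
      fun d hd => hY d ω.1 hd
  rw [hpair, hsnd, prob_indepLaw_fst, prob_indepLaw_fst p ν fun d => stat (x d)]
  ring

theorem mutualInfo_indepLaw_eq_zero [Finite D] [Finite R] (p : PMF D) (ν : PMF R) (v : D → α)
    (Y : D × R → β) (hY : ∀ d d', condLaw ν Y d = condLaw ν Y d') :
    mutualInfo (indepLaw p ν) (fun ω => v ω.1) Y = 0 := by
  rw [mutualInfo_indepLaw_eq_entropy p ν v Y (fun _ => ()) (fun d d' _ => hY d d')
    fun _ _ _ => rfl, entropy_const]

theorem condMutualInfo_indepLaw_eq_zero [Finite D] [Finite R] (p : PMF D) (ν : PMF R)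
    (v : D → α) (x : D → γ) (Y : D × R → β)
    (hY : ∀ d d', x d = x d' → condLaw ν Y d = condLaw ν Y d') :
    condMutualInfo (indepLaw p ν) (fun ω => v ω.1) Y (fun ω => x ω.1) = 0 := by
  refine condMutualInfo_eq_zero_of_prob_mul_eq fun ω => ?_
  have hpair : prob (indepLaw p ν) (fun ω => (Y ω, x ω.1)) (Y ω, x ω.1) =
      prob p x (x ω.1) * (condLaw ν Y ω.1 (Y ω)).toReal :=
    prob_indepLaw_of_iff p ν (fun _ => Prod.ext_iff.trans and_comm) fun d hd => hY d ω.1 hd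
  have htriple : prob (indepLaw p ν) (fun ω => (v ω.1, Y ω, x ω.1)) (v ω.1, Y ω, x ω.1) =
      prob p (fun d => (v d, x d)) (v ω.1, x ω.1) * (condLaw ν Y ω.1 (Y ω)).toReal :=
    prob_indepLaw_of_iff p ν (fun ω' => by simp only [Prod.mk.injEq]; tauto)
      fun d hd => hY d ω.1 (congrArg Prod.snd hd)
  rw [hpair, htriple, prob_indepLaw_fst p ν fun d => (v d, x d), prob_indepLaw_fst]
  ring

theorem sum_mul_mul_of_prob_pair [Fintype D] {p : PMF D} {v : D → α} {x : D → γ}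
    (hind : ∀ a b, prob p (fun d => (v d, x d)) (a, b) = prob p v a * prob p x b)
    (g : α → ℝ) (κ : γ → ℝ) :
    ∑ d, (p d).toReal * (g (v d) * κ (x d)) =
      (∑ d, (p d).toReal * g (v d)) * ∑ d, (p d).toReal * κ (x d) := by
  classical
  rw [← sum_prob_mul p v g, ← sum_prob_mul p x κ, Finset.sum_mul_sum, ← Finset.sum_product',
    ← sum_prob_mul p (fun d => (v d, x d)) fun c => g c.1 * κ c.2]
  refine (Finset.sum_subset (Finset.image_subset_iff.2 fun d _ => by simp) fun c _ hc => ?_).trans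
    (Finset.sum_congr rfl fun c _ => by rw [hind]; ring)
  rw [prob_eq_zero_of_forall_ne p _ (by simpa using hc), zero_mul]

theorem mutualInfo_indepLaw_eq_zero_of_mutualInfo_eq_zero [Finite D] [Finite R] (p : PMF D)
    (ν : PMF R) (v : D → α) (x : D → γ) (Y : D × R → β)
    (hY : ∀ d d', x d = x d' → condLaw ν Y d = condLaw ν Y d')
    (hvx : mutualInfo (indepLaw p ν) (fun ω => v ω.1) (fun ω => x ω.1) = 0) :
    mutualInfo (indepLaw p ν) (fun ω => v ω.1) Y = 0 := by
  classical
  cases nonempty_fintype D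
  have hind : ∀ a b, prob p (fun d => (v d, x d)) (a, b) = prob p v a * prob p x b := by
    intro a b
    rw [← prob_indepLaw_fst p ν v, ← prob_indepLaw_fst p ν x,
      ← mutualInfo_eq_zero_iff.1 hvx, prob_indepLaw_fst p ν fun d => (v d, x d)]
  refine mutualInfo_eq_zero_iff.2 fun a y => ?_
  obtain ⟨κ, hκ⟩ : ∃ κ : γ → ℝ, ∀ d, (condLaw ν Y d y).toReal = κ (x d) :=
    ((Function.factorsThrough_iff fun d => (condLaw ν Y d y).toReal).1 fun d d' h => by
      simp only [hY d d' h]).imp fun _ => congrFun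
  have hpair (d : D) : (condLaw ν (fun ω => (v ω.1, Y ω)) d (a, y)).toReal =
      (if v d = a then 1 else 0) * κ (x d) := by
    rw [toReal_condLaw_of_iff (a := a) (y := y) ν fun _ => Prod.ext_iff, hκ, boole_mul]
  have hv : prob p v a = ∑ d, (p d).toReal * if v d = a then 1 else 0 := by
    simp only [prob_eq_sum, Finset.sum_filter, mul_boole]
  simp only [prob_indepLaw_fst, prob_indepLaw p ν (fun ω => (v ω.1, Y ω)), prob_indepLaw p ν Y,
    hpair, hκ, hv]
  exact sum_mul_mul_of_prob_pair hind (fun b => if b = a then 1 else 0) κ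

theorem map_uniformOfFintype_equiv {R' : Type*} [Fintype R] [Nonempty R] [Fintype R']
    [Nonempty R'] (e : R ≃ R') :
    (PMF.uniformOfFintype R).map e = PMF.uniformOfFintype R' := by
  ext ρ
  rw [PMF.map_apply, tsum_eq_single (e.symm ρ)]
  · simp [Fintype.card_congr e]
  · intro ρ' hρ'
    rw [if_neg]
    rintro rfl
    simp at hρ'

theorem condLaw_uniform_eq_of_equiv [Fintype R] [Nonempty R] {Y Y' : D × R → β} {d d' : D}
    (e : R ≃ R) (h : ∀ ρ, Y (d, ρ) = Y' (d', e ρ)) :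
    condLaw (PMF.uniformOfFintype R) Y d = condLaw (PMF.uniformOfFintype R) Y' d' := by
  have hd : (fun ρ => Y (d, ρ)) = (fun ρ => Y' (d', ρ)) ∘ e := funext h
  rw [condLaw, hd, ← PMF.map_comp, map_uniformOfFintype_equiv, condLaw]

end IndependentNoise

section PolynomialFunctions

open Polynomial

variable {F ι κ : Type*} [Field F] {α : ι → F} {d e : ℕ} {g g' : ι → F}

/-- The functions of a database that are polynomials of degree at most `d` in its evaluation
point `α n`.  Noise and interference are known only up to such functions. -/
noncomputable def polyFun (α : ι → F) (d : ℕ) : Submodule F (ι → F) :=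
  (degreeLE F d).map (LinearMap.pi fun n => leval (α n))

theorem mem_polyFun : g ∈ polyFun α d ↔ ∃ q : F[X], q.natDegree ≤ d ∧ ∀ n, q.eval (α n) = g n := by
  simp only [polyFun, Submodule.mem_map, mem_degreeLE, ← natDegree_le_iff_degree_le, funext_iff,
    LinearMap.pi_apply, leval_apply]

theorem eval_mem_polyFun {q : F[X]} (hq : q.natDegree ≤ d) :
    (fun n => q.eval (α n)) ∈ polyFun α d :=
  mem_polyFun.2 ⟨q, hq, fun _ => rfl⟩

theorem polyFun_mono (h : d ≤ e) : polyFun α d ≤ polyFun α e :=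
  Submodule.map_mono (degreeLE_mono (WithBot.coe_le_coe.2 (Nat.cast_le.2 h)))

theorem mul_mem_polyFun (hg : g ∈ polyFun α d) (hg' : g' ∈ polyFun α e) :
    (fun n => g n * g' n) ∈ polyFun α (d + e) := by
  obtain ⟨q, hq, hqg⟩ := mem_polyFun.1 hg
  obtain ⟨q', hq', hqg'⟩ := mem_polyFun.1 hg'
  simp only [← hqg, ← hqg', ← eval_mul]
  exact eval_mem_polyFun (natDegree_mul_le_of_le hq hq')

theorem const_mem_polyFun (c : F) : (fun _ => c) ∈ polyFun α d := by
  simpa using eval_mem_polyFun (α := α) (q := C c) (d := d) (by simp)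

theorem mul_const_mem_polyFun (hg : g ∈ polyFun α d) (c : F) :
    (fun n => g n * c) ∈ polyFun α d :=
  mul_mem_polyFun (e := 0) hg (const_mem_polyFun c)

theorem pow_mem_polyFun (α : ι → F) (d : ℕ) : (fun n => α n ^ d) ∈ polyFun α d := by
  simpa using eval_mem_polyFun (α := α) (natDegree_X_pow_le (R := F) d)

theorem const_sub_mem_polyFun (c : F) : (fun n => c - α n) ∈ polyFun α 1 :=
  mem_polyFun.2 ⟨C c - X, by compute_degree, fun n => by rw [eval_sub, eval_C, eval_X]⟩

theorem add_mem_polyFun (hg : g ∈ polyFun α d) (hg' : g' ∈ polyFun α d) :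
    (fun n => g n + g' n) ∈ polyFun α d :=
  (polyFun α d).add_mem hg hg'

theorem sum_mem_polyFun {s : Finset κ} {g : κ → ι → F} (hg : ∀ k ∈ s, g k ∈ polyFun α d) :
    (fun n => ∑ k ∈ s, g k n) ∈ polyFun α d := by
  simpa only [Finset.sum_fn] using (polyFun α d).sum_mem hg

theorem mem_polyFun_iff_exists_coeff :
    g ∈ polyFun α d ↔ ∃ c : Fin (d + 1) → F, ∀ n, g n = ∑ j : Fin (d + 1), α n ^ (j : ℕ) * c j := by
  constructor
  · intro hg
    obtain ⟨q, hq, hqg⟩ := mem_polyFun.1 hg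
    refine ⟨fun j => q.coeff j, fun n => ?_⟩
    rw [← hqg, eval_eq_sum_range' (Nat.lt_succ_of_le hq),
      Finset.sum_range fun i => q.coeff i * α n ^ i]
    exact Finset.sum_congr rfl fun j _ => mul_comm _ _
  · rintro ⟨c, hc⟩
    rw [funext hc]
    exact sum_mem_polyFun fun j _ =>
      polyFun_mono (Nat.lt_succ_iff.1 j.2) (mul_const_mem_polyFun (pow_mem_polyFun α j) (c j))

theorem inv_mul_eval_sub_mem_polyFun {q : F[X]} (hq : q.natDegree ≤ d + 1) {c : F}
    (hc : ∀ n, c ≠ α n) :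
    (fun n => (c - α n)⁻¹ * (q.eval (α n) - q.eval c)) ∈ polyFun α d := by
  have hdeg : (-(q /ₘ (X - C c))).natDegree ≤ d := by
    rw [natDegree_neg, natDegree_divByMonic _ (monic_X_sub_C c), natDegree_X_sub_C]
    omega
  refine mem_polyFun.2 ⟨_, hdeg, fun n => ?_⟩
  have hdiv := congrArg (eval (α n)) (modByMonic_add_div q (X - C c))
  simp only [modByMonic_X_sub_C_eq_C_eval, eval_add, eval_mul, eval_sub, eval_C, eval_X] at hdiv
  rw [eval_neg, eq_inv_mul_iff_mul_eq₀ (sub_ne_zero.2 (hc n)), ← hdiv]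
  ring

theorem eq_zero_of_div_mem_polyFun [Fintype ι] {q r : F[X]} (hα : Function.Injective α)
    (hq : ∀ n, q.eval (α n) ≠ 0) (hrq : r.degree < q.degree)
    (hd : d + q.natDegree < Fintype.card ι)
    (h : (fun n => r.eval (α n) / q.eval (α n)) ∈ polyFun α d) : r = 0 := by
  obtain ⟨p, hp, hpr⟩ := mem_polyFun.1 h
  have hdeg : (r - q * p).natDegree ≤ d + q.natDegree := by
    refine (natDegree_sub_le_of_le (natDegree_le_natDegree hrq.le) natDegree_mul_le).trans ?_
    omega
  have heval (n : ι) : (r - q * p).eval (α n) = 0 := by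
    rw [eval_sub, eval_mul, hpr, mul_div_cancel₀ _ (hq n), sub_self]
  have hdvd : q ∣ r := ⟨p, sub_eq_zero.1
    (eq_zero_of_natDegree_lt_card_of_eval_eq_zero _ hα heval (hdeg.trans_lt hd))⟩
  exact eq_zero_of_dvd_of_degree_lt hdvd hrq

end PolynomialFunctions

section PolarParts

open Polynomial

variable {F ι : Type*} [Field F] {α : ι → F} {ℓ d : ℕ} {f : Fin ℓ → F} {g : ι → F}

/-- The part of an uncoded answer that carries `v`: simple poles at the `f k`, as a function of the
evaluation point `a`. -/
def simplePoles (f : Fin ℓ → F) (a : F) (v : Fin ℓ → F) : F :=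
  ∑ k, (f k - a)⁻¹ * v k

/-- The part of an MDS coded symbol that carries `v`: a pole of order at most `ℓ` at the origin,
as a function of the evaluation point `a`. -/
def originPole (a : F) (v : Fin ℓ → F) : F :=
  ∑ i : Fin ℓ, (a ^ ((i : ℕ) + 1))⁻¹ * v i

theorem simplePoles_sub (a : F) (v v' : Fin ℓ → F) :
    simplePoles f a (v - v') = simplePoles f a v - simplePoles f a v' := by
  simp only [simplePoles, Pi.sub_apply, mul_sub, Finset.sum_sub_distrib]

theorem originPole_sub (a : F) (v v' : Fin ℓ → F) :
    originPole a (v - v') = originPole a v - originPole a v' := by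
  simp only [originPole, Pi.sub_apply, mul_sub, Finset.sum_sub_distrib]

theorem simplePoles_eq_div (hf : Function.Injective f) {a : F} (ha : ∀ k, f k ≠ a)
    (v : Fin ℓ → F) :
    simplePoles f a v =
      (Lagrange.interpolate Finset.univ f
        fun k => -(Lagrange.nodalWeight Finset.univ f k)⁻¹ * v k).eval a /
      (Lagrange.nodal Finset.univ f).eval a := by
  have hnodal : (Lagrange.nodal Finset.univ f).eval a ≠ 0 :=
    Lagrange.eval_nodal_not_at_node fun k _ => (ha k).symm
  rw [Lagrange.eval_interpolate_not_at_node _ fun k _ => (ha k).symm, mul_div_cancel_left₀ _ hnodal]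
  refine Finset.sum_congr rfl fun k _ => ?_
  have hweight : Lagrange.nodalWeight Finset.univ f k ≠ 0 :=
    Lagrange.nodalWeight_ne_zero hf.injOn (Finset.mem_univ k)
  rw [← neg_sub a, inv_neg]
  field_simp

theorem pow_mul_originPole [DecidableEq F] {a : F} (ha : a ≠ 0) (v : Fin ℓ → F) :
    a ^ ℓ * originPole a v = (ofFn ℓ (v ∘ Fin.rev)).eval a := by
  simp only [ofFn_eq_sum_monomial, eval_finsetSum, eval_monomial, originPole, Finset.mul_sum]
  refine Fintype.sum_equiv Fin.revPerm _ _ fun i => ?_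
  have hpow : a ^ ℓ = a ^ (Fin.rev i : ℕ) * a ^ ((i : ℕ) + 1) := by
    rw [← pow_add, Fin.val_rev, Nat.sub_add_cancel i.2]
  rw [hpow]
  simp only [Fin.revPerm_apply, Function.comp_apply, Fin.rev_rev]
  field_simp

theorem pow_mul_originPole_mem_polyFun (hα₀ : ∀ n, α n ≠ 0) (v : Fin ℓ → F) :
    (fun n => α n ^ ℓ * originPole (α n) v) ∈ polyFun α ℓ := by
  classical
  simp only [pow_mul_originPole (hα₀ _)]
  exact eval_mem_polyFun (natDegree_le_iff_degree_le.2 (ofFn_degree_lt _).le)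

theorem eq_zero_of_simplePoles_mem_polyFun [Fintype ι] (hf : Function.Injective f)
    (hα : Function.Injective α) (hfα : ∀ k n, f k ≠ α n) (hd : d + ℓ < Fintype.card ι)
    {v : Fin ℓ → F} (hv : (fun n => simplePoles f (α n) v) ∈ polyFun α d) : v = 0 := by
  simp only [simplePoles_eq_div hf fun k => hfα k _] at hv
  have hzero := eq_zero_of_div_mem_polyFun hα
    (fun n => Lagrange.eval_nodal_not_at_node fun k _ => (hfα k n).symm)
    ((Lagrange.degree_interpolate_lt _ hf.injOn).trans_eq Lagrange.degree_nodal.symm)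
    (by rwa [Lagrange.natDegree_nodal, Finset.card_univ, Fintype.card_fin]) hv
  funext k
  have hk := congrArg (eval (f k)) hzero
  rw [Lagrange.eval_interpolate_at_node _ hf.injOn (Finset.mem_univ k), eval_zero] at hk
  exact (mul_eq_zero.1 hk).resolve_left
    (neg_ne_zero.2 (inv_ne_zero (Lagrange.nodalWeight_ne_zero hf.injOn (Finset.mem_univ k))))

theorem eq_zero_of_originPole_mem_polyFun [Fintype ι] (hα : Function.Injective α)
    (hα₀ : ∀ n, α n ≠ 0) (hd : d + ℓ < Fintype.card ι) {v : Fin ℓ → F}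
    (hv : (fun n => originPole (α n) v) ∈ polyFun α d) : v = 0 := by
  classical
  have hdiv (n : ι) : originPole (α n) v =
      (ofFn ℓ (v ∘ Fin.rev)).eval (α n) / (X ^ ℓ : F[X]).eval (α n) := by
    rw [← pow_mul_originPole (hα₀ n), eval_pow, eval_X,
      mul_div_cancel_left₀ _ (pow_ne_zero ℓ (hα₀ n))]
  simp only [hdiv] at hv
  have hzero := eq_zero_of_div_mem_polyFun hα
    (fun n => by rw [eval_pow, eval_X]; exact pow_ne_zero ℓ (hα₀ n))
    ((ofFn_degree_lt _).trans_eq (degree_X_pow ℓ).symm) (by rwa [natDegree_X_pow]) hv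
  have hrev : v ∘ Fin.rev = 0 := injective_ofFn ℓ (hzero.trans (ofFn_zero ℓ).symm)
  funext i
  simpa using congrFun hrev i.rev

theorem eq_of_sub_simplePoles_mem_polyFun [Fintype ι] (hf : Function.Injective f)
    (hα : Function.Injective α) (hfα : ∀ k n, f k ≠ α n) (hd : d + ℓ < Fintype.card ι)
    {v v' : Fin ℓ → F} (hv : (fun n => g n - simplePoles f (α n) v) ∈ polyFun α d)
    (hv' : (fun n => g n - simplePoles f (α n) v') ∈ polyFun α d) : v = v' := by
  refine sub_eq_zero.1 (eq_zero_of_simplePoles_mem_polyFun hf hα hfα hd ?_)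
  convert (polyFun α d).sub_mem hv' hv using 2 with n
  rw [simplePoles_sub, Pi.sub_apply]
  ring

theorem eq_of_sub_originPole_mem_polyFun [Fintype ι] (hα : Function.Injective α)
    (hα₀ : ∀ n, α n ≠ 0) (hd : d + ℓ < Fintype.card ι) {v v' : Fin ℓ → F}
    (hv : (fun n => g n - originPole (α n) v) ∈ polyFun α d)
    (hv' : (fun n => g n - originPole (α n) v') ∈ polyFun α d) : v = v' := by
  refine sub_eq_zero.1 (eq_zero_of_originPole_mem_polyFun hα hα₀ hd ?_)
  convert (polyFun α d).sub_mem hv' hv using 2 with n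
  rw [originPole_sub, Pi.sub_apply]
  ring

theorem exists_eval_eq_uncodedComb (hf : Function.Injective f) (δ : Fin ℓ → F) (z : F) :
    ∃ q : F[X], q.natDegree ≤ ℓ ∧ (∀ a, q.eval a = uncodedComb f a δ z) ∧
      ∀ k, q.eval (f k) = δ k := by
  refine ⟨Lagrange.interpolate Finset.univ f δ + (∏ j, (C (f j) - X)) * C z, ?_, fun a => ?_,
    fun k => ?_⟩
  · refine natDegree_add_le_of_degree_le (natDegree_le_iff_degree_le.2 ?_)
      ((natDegree_mul_C_le _ _).trans ((natDegree_prod_le _ _).trans ?_))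
    · simpa using (Lagrange.degree_interpolate_lt (s := Finset.univ) δ hf.injOn).le
    · have h1 (j : Fin ℓ) : (C (f j) - X).natDegree ≤ 1 := by compute_degree
      simpa using Finset.sum_le_sum fun j (_ : j ∈ Finset.univ) => h1 j
  · have hdivisor (j k : Fin ℓ) :
        (Lagrange.basisDivisor (f k) (f j)).eval a = (f j - a) / (f j - f k) := by
      rw [Lagrange.basisDivisor, eval_mul, eval_C, eval_sub, eval_X, eval_C, inv_mul_eq_div,
        ← neg_sub (f j) a, ← neg_sub (f j) (f k), neg_div_neg_eq]
    simp only [uncodedComb, Lagrange.interpolate_apply, Lagrange.basis, eval_add, eval_finsetSum,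
      eval_mul, eval_prod, eval_C, eval_sub, eval_X, hdivisor, Finset.prod_div_distrib]
    congr 1
    exact Finset.sum_congr rfl fun k _ => mul_div_left_comm _ _ _
  · rw [eval_add, Lagrange.eval_interpolate_at_node _ hf.injOn (Finset.mem_univ k), eval_mul,
      eval_prod, Finset.prod_eq_zero (Finset.mem_univ k) (by simp), zero_mul, add_zero]

theorem inv_mul_uncodedComb_sub_mem_polyFun {f : Fin (ℓ + 1) → F} (hf : Function.Injective f)
    (hfα : ∀ k n, f k ≠ α n) (δ : Fin (ℓ + 1) → F) (z : F) (k : Fin (ℓ + 1)) :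
    (fun n => (f k - α n)⁻¹ * uncodedComb f (α n) δ z - (f k - α n)⁻¹ * δ k) ∈ polyFun α ℓ := by
  obtain ⟨q, hq, hqa, hqf⟩ := exists_eval_eq_uncodedComb hf δ z
  simp only [← hqa, ← hqf k, ← mul_sub]
  exact inv_mul_eval_sub_mem_polyFun hq (hfα k)

theorem uncodedSymbol_sub_mem_polyFun (c w : F) (z : Fin (d + 1) → F) :
    (fun n => uncodedSymbol c (α n) w z - (c - α n)⁻¹ * w) ∈ polyFun α d :=
  mem_polyFun_iff_exists_coeff.2 ⟨z, fun _ => add_sub_cancel_left _ _⟩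

theorem codedSymbol_sub_mem_polyFun (w : Fin ℓ → F) (z : Fin (d + 1) → F) :
    (fun n => codedSymbol (α n) w z - originPole (α n) w) ∈ polyFun α d :=
  mem_polyFun_iff_exists_coeff.2 ⟨z, fun _ => add_sub_cancel_left _ _⟩

theorem codedComb_sub_mem_polyFun (δ : Fin ℓ → F) (z : F) :
    (fun n => codedComb (α n) δ z - originPole (α n) δ) ∈ polyFun α 0 := by
  simpa only [codedComb, originPole, add_sub_cancel_left] using const_mem_polyFun z

end PolarParts

section NoisyReversing

/-- The matrix on subpackets obtained from the `k`-th row of each block by summing the `ℓ` columns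
of the block and clearing the factor `1 / (f k - a)`. -/
def collapse {F T : Type*} [Field F] {ℓ : ℕ} (f : Fin ℓ → F) (a : F)
    (A : Matrix (T × Fin ℓ) (T × Fin ℓ) F) (k : Fin ℓ) (s t : T) : F :=
  (f k - a) * ∑ h, A (s, k) (t, h)

theorem mulVec_eq_sum_mul_collapse {F T : Type*} [Field F] [Fintype T] {ℓ : ℕ} {f : Fin ℓ → F}
    {a : F} {k : Fin ℓ} (h : f k ≠ a) (A : Matrix (T × Fin ℓ) (T × Fin ℓ) F) (u : T → F) (s : T) :
    A.mulVec (fun b => u b.1) (s, k) = ∑ t, (f k - a)⁻¹ * u t * collapse f a A k s t := by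
  simp only [Matrix.mulVec, dotProduct, Fintype.sum_prod_type, ← Finset.sum_mul]
  refine Finset.sum_congr rfl fun t _ => ?_
  rw [collapse, mul_mul_mul_comm, inv_mul_cancel₀ (sub_ne_zero.2 h), one_mul,
    mul_comm]

variable {F ι T : Type*} [Field F] [DecidableEq T] {α : ι → F} {μ ℓ d e : ℕ}

/-- The matrices `A n` of the databases reverse the permutation `τ` up to noise: their entries are
those of the permutation matrix of `τ`, plus `M n` times polynomials of degree at most `e` in the
evaluation points.  The mask `M` is what makes the noise harmless in products with stored data:
it clears the poles of the data. -/
def IsNoisyReversing (α M : ι → F) (e : ℕ) (τ : Equiv.Perm T) (A : ι → T → T → F) : Prop :=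
  ∀ s t, ∃ c ∈ polyFun α e, ∀ n, A n s t = (if s = τ t then 1 else 0) + M n * c n

theorem sum_mul_sub_mem_polyFun [Fintype T] {M : ι → F} (hM : M ∈ polyFun α μ) {p S A : T → ι → F}
    (hp : ∀ s, (fun n => M n * p s n) ∈ polyFun α μ)
    (hS : ∀ s, (fun n => S s n - p s n) ∈ polyFun α d) {t : T}
    (hA : ∀ s, ∃ c ∈ polyFun α e, ∀ n, A s n = (if s = t then 1 else 0) + M n * c n) :
    (fun n => ∑ s, S s n * A s n - p t n) ∈ polyFun α (μ + d + e) := by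
  choose c hc hA using hA
  have hMS (s : T) : (fun n => M n * S s n) ∈ polyFun α (μ + d) := by
    convert add_mem_polyFun (mul_mem_polyFun hM (hS s))
      (polyFun_mono (Nat.le_add_right μ d) (hp s)) using 2 with n
    ring
  convert add_mem_polyFun (polyFun_mono (by omega) (hS t))
    (sum_mem_polyFun fun s (_ : s ∈ Finset.univ) => mul_mem_polyFun (hMS s) (hc s)) using 2 with n
  simp only [hA, mul_add, mul_ite, mul_one, mul_zero, Finset.sum_add_distrib, Finset.sum_ite_eq',
    Finset.mem_univ, if_true]
  rw [add_sub_right_comm]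
  exact congrArg _ (Finset.sum_congr rfl fun s _ => by ring)

section Coded

variable [Fintype T] {τ : Equiv.Perm T} {A : ι → T → T → F}

theorem coded_answer_sub_mem_polyFun (hα₀ : ∀ n, α n ≠ 0)
    (hA : IsNoisyReversing α (fun n => α n ^ ℓ) e τ A) {S : ι → T → F} {w : T → Fin ℓ → F}
    (hS : ∀ s, (fun n => S n s - originPole (α n) (w s)) ∈ polyFun α d) (t : T) :
    (fun n => ∑ s, S n s * A n s t - originPole (α n) (w (τ t))) ∈ polyFun α (ℓ + d + e) :=
  sum_mul_sub_mem_polyFun (pow_mem_polyFun α ℓ) (p := fun s n => originPole (α n) (w s))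
    (fun s => pow_mul_originPole_mem_polyFun hα₀ (w s)) hS fun s => hA s t

theorem coded_increment_sub_mem_polyFun (hα₀ : ∀ n, α n ≠ 0)
    (hA : IsNoisyReversing α (fun n => α n ^ ℓ) e τ A) (Δ : T → Fin ℓ → F) (u : T → F) (s : T) :
    (fun n => ∑ t, A n s t * codedComb (α n) (Δ (τ t)) (u t) - originPole (α n) (Δ s)) ∈
      polyFun α (ℓ + e) := by
  have hterm := sum_mul_sub_mem_polyFun (t := τ.symm s) (pow_mem_polyFun α ℓ)
    (fun t => pow_mul_originPole_mem_polyFun hα₀ (Δ (τ t)))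
    (fun t => codedComb_sub_mem_polyFun (Δ (τ t)) (u t))
    fun t => by simpa only [Equiv.eq_symm_apply, eq_comm] using hA s t
  simpa only [Equiv.apply_symm_apply, add_zero, mul_comm] using hterm

end Coded

section Uncoded

variable [Fintype T] {f : Fin ℓ → F} {τ : Equiv.Perm T} {A : ι → Matrix (T × Fin ℓ) (T × Fin ℓ) F}

theorem sub_mul_inv_sub_mul_mem_polyFun {c : F} (hc : ∀ n, c ≠ α n) (w : F) :
    (fun n => (c - α n) * ((c - α n)⁻¹ * w)) ∈ polyFun α 1 := by
  simpa only [mul_inv_cancel_left₀ (sub_ne_zero.2 (hc _))] using const_mem_polyFun w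

theorem uncoded_answer_sub_mem_polyFun (hfα : ∀ k n, f k ≠ α n)
    (hA : ∀ k, IsNoisyReversing α (fun n => f k - α n) e τ fun n => collapse f (α n) (A n) k)
    {S : ι → T → Fin ℓ → F} {w : T → Fin ℓ → F}
    (hS : ∀ s k, (fun n => S n s k - (f k - α n)⁻¹ * w s k) ∈ polyFun α d) (t : T) :
    (fun n => ∑ s, ∑ k, S n s k * collapse f (α n) (A n) k s t - simplePoles f (α n) (w (τ t))) ∈
      polyFun α (1 + d + e) := by
  convert sum_mem_polyFun fun k (_ : k ∈ Finset.univ) =>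
    sum_mul_sub_mem_polyFun (const_sub_mem_polyFun (f k))
      (p := fun s n => (f k - α n)⁻¹ * w s k)
      (fun s => sub_mul_inv_sub_mul_mem_polyFun (hfα k) (w s k)) (fun s => hS s k)
      fun s => hA k s t using 2 with n
  rw [Finset.sum_sub_distrib, Finset.sum_comm, simplePoles]

theorem uncoded_increment_sub_mem_polyFun {f : Fin (ℓ + 1) → F}
    {A : ι → Matrix (T × Fin (ℓ + 1)) (T × Fin (ℓ + 1)) F} (hf : Function.Injective f)
    (hfα : ∀ k n, f k ≠ α n)
    (hA : ∀ k, IsNoisyReversing α (fun n => f k - α n) e τ fun n => collapse f (α n) (A n) k)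
    (Δ : T → Fin (ℓ + 1) → F) (u : T → F) (s : T) (k : Fin (ℓ + 1)) :
    (fun n => (A n).mulVec (fun b => uncodedComb f (α n) (Δ (τ b.1)) (u b.1)) (s, k) -
      (f k - α n)⁻¹ * Δ s k) ∈ polyFun α (ℓ + 1 + e) := by
  have hterm := sum_mul_sub_mem_polyFun (t := τ.symm s) (const_sub_mem_polyFun (f k))
    (fun t => sub_mul_inv_sub_mul_mem_polyFun (hfα k) (Δ (τ t) k))
    (fun t => inv_mul_uncodedComb_sub_mem_polyFun hf hfα (Δ (τ t)) (u t) k)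
    fun t => by simpa only [Equiv.eq_symm_apply, eq_comm] using hA k s t
  rw [add_comm 1 ℓ] at hterm
  rw [Equiv.apply_symm_apply] at hterm
  refine (congrArg (· ∈ polyFun α (ℓ + 1 + e)) (funext fun n => ?_)).mpr hterm
  rw [mulVec_eq_sum_mul_collapse (hfα k n) (A n) fun t => uncodedComb f (α n) (Δ (τ t)) (u t)]

end Uncoded

end NoisyReversing

section ReversingMatrices

variable {F ι : Type*} [Field F] {B m ℓ : ℕ} {f : Fin ℓ → F} {α : ι → F}

theorem eq_twoStageIdx_iff {π : Fin B → Equiv.Perm (Fin m)} {σ : Equiv.Perm (Fin B)}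
    {s t : Sub B m} : s = twoStageIdx π σ t ↔ s.1 = σ t.1 ∧ s.2 = π s.1 t.2 := by
  rw [twoStageIdx, Equiv.prodShear_apply, Prod.ext_iff]
  exact and_congr_right fun h => by rw [h]

theorem uncodedRev_apply (a : F) (π : Equiv.Perm (Fin m))
    (Z : Matrix (Fin m × Fin ℓ) (Fin m × Fin ℓ) F) (s t : Fin m) (k h : Fin ℓ) :
    uncodedRev f a π Z (s, k) (t, h) =
      (if s = π t then 1 else 0) * (if k = h then (f k - a)⁻¹ else 0) + Z (s, k) (t, h) :=
  rfl

theorem uncodedInterRev_apply (a : F) (σ : Equiv.Perm (Fin B))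
    (Z : Matrix (Fin B × Fin ℓ) (Fin B × Fin ℓ) F) (i j : Fin B) (k h : Fin ℓ) :
    uncodedInterRev f a σ Z (i, k) (j, h) =
      (if i = σ j then 1 else 0) * (if k = h then 1 else 0) + (f k - a) * Z (i, k) (j, h) := by
  rw [uncodedInterRev, Matrix.add_apply, ← Matrix.diagonal_one, ← Matrix.diagonal_one,
    Matrix.diagonal_kronecker_diagonal, Matrix.diagonal_mul, one_mul]
  rfl

theorem isNoisyReversing_collapse_uncodedRev (hfα : ∀ k n, f k ≠ α n) (π : Equiv.Perm (Fin m))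
    (Z : Matrix (Fin m × Fin ℓ) (Fin m × Fin ℓ) F) (k : Fin ℓ) :
    IsNoisyReversing α (fun n => f k - α n) 0 π
      fun n => collapse f (α n) (uncodedRev f (α n) π Z) k := fun s t => by
  refine ⟨_, const_mem_polyFun (∑ h, Z (s, k) (t, h)), fun n => ?_⟩
  simp only [collapse, uncodedRev_apply, Finset.sum_add_distrib, ← Finset.mul_sum,
    Finset.sum_ite_eq, Finset.mem_univ, if_true, mul_add]
  rw [mul_left_comm, mul_inv_cancel₀ (sub_ne_zero.2 (hfα k n)), mul_one]

theorem collapse_uncodedCombined_uncodedRev {a : F} {k : Fin ℓ} (hk : f k ≠ a)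
    (π : Fin B → Equiv.Perm (Fin m)) (Z : Fin B → Matrix (Fin m × Fin ℓ) (Fin m × Fin ℓ) F)
    (H : Matrix (Fin B × Fin ℓ) (Fin B × Fin ℓ) F) (i j : Fin B) (s t : Fin m) :
    collapse f a (uncodedCombined (fun j => uncodedRev f a (π j) (Z j)) H) k (i, s) (j, t) =
      (if s = π i t then 1 else 0) * (∑ h', H (i, k) (j, h')) +
        (f k - a) * ∑ h, (∑ h', H (i, h) (j, h')) * Z i (s, k) (t, h) := by
  have hcomm : ∑ h', uncodedCombined (fun j => uncodedRev f a (π j) (Z j)) H ((i, s), k)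
      ((j, t), h') = ∑ h, uncodedRev f a (π i) (Z i) (s, k) (t, h) * ∑ h', H (i, h) (j, h') := by
    simp only [uncodedCombined, Matrix.of_apply, Finset.mul_sum]
    rw [Finset.sum_comm]
  rw [collapse, hcomm]
  simp only [uncodedRev_apply, add_mul, mul_ite, mul_zero, ite_mul, zero_mul,
    Finset.sum_add_distrib, Finset.sum_ite_eq, Finset.mem_univ, if_true, mul_add]
  congr 1
  · have hne := sub_ne_zero.2 hk
    split_ifs <;> field_simp
  · simp only [mul_comm]

theorem isNoisyReversing_collapse_uncodedCombined (hfα : ∀ k n, f k ≠ α n)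
    (π : Fin B → Equiv.Perm (Fin m)) (σ : Equiv.Perm (Fin B))
    (Z : Fin B → Matrix (Fin m × Fin ℓ) (Fin m × Fin ℓ) F)
    (Z' : Matrix (Fin B × Fin ℓ) (Fin B × Fin ℓ) F) (k : Fin ℓ) :
    IsNoisyReversing α (fun n => f k - α n) 1 (twoStageIdx π σ) fun n =>
      collapse f (α n) (uncodedCombined (fun j => uncodedRev f (α n) (π j) (Z j))
        (uncodedInterRev f (α n) σ Z')) k := by
  rintro ⟨i, a⟩ ⟨j, b⟩
  let row : Fin ℓ → F := fun h => ∑ h', Z' (i, h) (j, h')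
  refine ⟨_, add_mem_polyFun (const_mem_polyFun ((if a = π i b then 1 else 0) * row k))
    (sum_mem_polyFun fun h (_ : h ∈ Finset.univ) => add_mem_polyFun
      (const_mem_polyFun ((if i = σ j then 1 else 0) * Z i (a, k) (b, h)))
      (mul_const_mem_polyFun (const_sub_mem_polyFun (f h)) (row h * Z i (a, k) (b, h)))),
    fun n => ?_⟩
  have hinter (h : Fin ℓ) : ∑ h', uncodedInterRev f (α n) σ Z' (i, h) (j, h') =
      (if i = σ j then 1 else 0) + (f h - α n) * row h := by
    simp only [uncodedInterRev_apply, Finset.sum_add_distrib, ← Finset.mul_sum,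
      Finset.sum_ite_eq, Finset.mem_univ, if_true, mul_one, row]
  beta_reduce
  rw [collapse_uncodedCombined_uncodedRev (hfα k n)]
  simp only [hinter, eq_twoStageIdx_iff, ite_and, Finset.mul_sum, add_mul, mul_add]
  split_ifs <;> simp only [one_mul, zero_mul, mul_assoc, zero_add, add_zero] <;> ring

theorem isNoisyReversing_codedRev (π : Equiv.Perm (Fin m)) (Z : Matrix (Fin m) (Fin m) F) :
    IsNoisyReversing α (fun n => α n ^ ℓ) 0 π fun n => codedRev ℓ (α n) π Z :=
  fun s t => ⟨_, const_mem_polyFun (Z s t), fun _ => rfl⟩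

theorem isNoisyReversing_codedCombined (π : Fin B → Equiv.Perm (Fin m)) (σ : Equiv.Perm (Fin B))
    (Z : Fin B → Matrix (Fin m) (Fin m) F) (Z' : Matrix (Fin B) (Fin B) F) :
    IsNoisyReversing α (fun n => α n ^ ℓ) ℓ (twoStageIdx π σ) fun n =>
      codedCombined (fun j => codedRev ℓ (α n) (π j) (Z j)) (codedRev ℓ (α n) σ Z') := by
  rintro ⟨i, a⟩ ⟨j, b⟩
  refine ⟨_, add_mem_polyFun (const_mem_polyFun
      ((if a = π i b then 1 else 0) * Z' i j + Z i a b * if i = σ j then 1 else 0))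
    (mul_const_mem_polyFun (pow_mem_polyFun α ℓ) (Z i a b * Z' i j)), fun n => ?_⟩
  simp only [codedCombined, codedRev, permRev, Matrix.of_apply, Matrix.add_apply,
    Matrix.smul_apply, smul_eq_mul, eq_twoStageIdx_iff, ite_and]
  split_ifs <;> ring

end ReversingMatrices

section PositionsAndPermutations

variable {B m K : ℕ}

theorem Positions.nth_injective (x : Positions B m K) : Function.Injective x.nth :=
  finProdFinEquiv.symm.injective.comp (Finset.orderEmbOfFin _ _).injective

theorem Positions.range_nth (x : Positions B m K) : Set.range x.nth = x.1 := by
  have hnth : x.nth = finProdFinEquiv.symm ∘ ((x.1.map finProdFinEquiv.toEmbedding).orderEmbOfFin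
      ((Finset.card_map _).trans x.2)) := rfl
  rw [hnth, Set.range_comp, Finset.range_orderEmbOfFin, Finset.coe_map, Equiv.coe_toEmbedding,
    Equiv.symm_image_image]

theorem Positions.mem_iff_exists_nth (x : Positions B m K) (s : Sub B m) :
    s ∈ x.1 ↔ ∃ i, x.nth i = s := by
  rw [← Finset.mem_coe, ← x.range_nth, Set.mem_range]

theorem Positions.ext_nth {x x' : Positions B m K} (h : x.nth = x'.nth) : x = x' :=
  Subtype.ext <| Finset.coe_injective <| by rw [← x.range_nth, ← x'.range_nth, h]

theorem Positions.mem_permuted (σ : Equiv.Perm (Sub B m)) (x : Positions B m K) (s : Sub B m) :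
    s ∈ (x.permuted σ).1 ↔ σ s ∈ x.1 :=
  Finset.mem_map_equiv

theorem segCounts_eq_card (x : Positions B m K) (j : Fin B) :
    segCounts x j = (Finset.univ.filter fun t => (j, t) ∈ x.1).card := by
  rw [segCounts, ← Finset.card_map (Function.Embedding.sectR j (Fin m))]
  congr 1
  ext ⟨i, t⟩
  simp only [Finset.mem_filter, Finset.mem_map, Finset.mem_univ, true_and,
    Function.Embedding.sectR_apply, Prod.mk.injEq]
  grind

theorem segCounts_permuted_twoStageIdx (π : Fin B → Equiv.Perm (Fin m)) (σ : Equiv.Perm (Fin B))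
    (x : Positions B m K) : segCounts (x.permuted (twoStageIdx π σ)) = segCounts x ∘ σ := by
  funext j
  simp only [Function.comp_apply, segCounts_eq_card, Positions.mem_permuted]
  exact Finset.card_equiv (π (σ j)) fun t => by simp [twoStageIdx]

theorem segCounts_permuted_withinIdx (π : Fin B → Equiv.Perm (Fin m)) (x : Positions B m K) :
    segCounts (x.permuted (withinIdx π)) = segCounts x :=
  segCounts_permuted_twoStageIdx π (Equiv.refl _) x

theorem unorderedCounts_permuted_twoStageIdx (π : Fin B → Equiv.Perm (Fin m))
    (σ : Equiv.Perm (Fin B)) (x : Positions B m K) :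
    unorderedCounts (x.permuted (twoStageIdx π σ)) = unorderedCounts x := by
  rw [unorderedCounts, segCounts_permuted_twoStageIdx, ← Multiset.map_map,
    Multiset.map_univ_val_equiv, unorderedCounts]

theorem exists_perm_of_card_fiber_eq {α β : Type*} [Fintype α] [DecidableEq β] (g g' : α → β)
    (h : ∀ c, (Finset.univ.filter fun a => g a = c).card =
      (Finset.univ.filter fun a => g' a = c).card) :
    ∃ σ : Equiv.Perm α, ∀ a, g' (σ a) = g a := by
  have hfiber (c : β) : Nonempty ({a // g a = c} ≃ {a // g' a = c}) := by
    rw [← Fintype.card_eq, Fintype.card_subtype, Fintype.card_subtype, h]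
  exact ⟨Equiv.ofFiberEquiv fun c => (hfiber c).some, Equiv.ofFiberEquiv_map _⟩

theorem exists_perm_mem_iff {α : Type*} [Finite α] {s t : Finset α} (h : s.card = t.card) :
    ∃ σ : Equiv.Perm α, ∀ a, σ a ∈ t ↔ a ∈ s := by
  classical
  cases nonempty_fintype α
  obtain ⟨σ, hσ⟩ := exists_perm_of_card_fiber_eq (· ∈ s) (· ∈ t) fun c => by
    by_cases hc : c <;> simp [hc, Finset.filter_not, Finset.card_univ_sdiff, h]
  exact ⟨σ, fun a => iff_of_eq (hσ a)⟩

theorem exists_withinPerm_mem_iff {x x' : Positions B m K} {σ : Equiv.Perm (Fin B)}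
    (h : ∀ j, segCounts x' (σ j) = segCounts x j) :
    ∃ π : Fin B → Equiv.Perm (Fin m), ∀ j t, (σ j, π j t) ∈ x'.1 ↔ (j, t) ∈ x.1 := by
  have hperm (j : Fin B) : ∃ π : Equiv.Perm (Fin m), ∀ t, (σ j, π t) ∈ x'.1 ↔ (j, t) ∈ x.1 := by
    simp only [segCounts_eq_card] at h
    simpa using exists_perm_mem_iff (h j).symm
  exact Classical.skolem.1 hperm

theorem exists_withinIdx_equiv {x x' : Positions B m K} (h : segCounts x = segCounts x') :
    ∃ e : (Fin B → Equiv.Perm (Fin m)) ≃ (Fin B → Equiv.Perm (Fin m)),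
      ∀ π, x.permuted (withinIdx π) = x'.permuted (withinIdx (e π)) := by
  obtain ⟨π₀, h₀⟩ := exists_withinPerm_mem_iff (σ := 1) fun j => (congrFun h j).symm
  refine ⟨Equiv.mulLeft π₀, fun π => ?_⟩
  ext ⟨j, t⟩
  rw [Positions.mem_permuted, Positions.mem_permuted]
  exact (h₀ j (π j t)).symm

theorem exists_twoStageIdx_equiv {x x' : Positions B m K}
    (h : unorderedCounts x = unorderedCounts x') :
    ∃ e : ((Fin B → Equiv.Perm (Fin m)) × Equiv.Perm (Fin B)) ≃
        ((Fin B → Equiv.Perm (Fin m)) × Equiv.Perm (Fin B)),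
      ∀ κ, x.permuted (twoStageIdx κ.1 κ.2) = x'.permuted (twoStageIdx (e κ).1 (e κ).2) := by
  obtain ⟨σ₀, hσ₀⟩ := exists_perm_of_card_fiber_eq (segCounts x) (segCounts x') fun c => by
    have hcount := congrArg (Multiset.count c) h
    simp only [unorderedCounts, Multiset.count_map] at hcount
    simpa [Finset.card, eq_comm] using hcount
  obtain ⟨π₀, h₀⟩ := exists_withinPerm_mem_iff hσ₀
  refine ⟨((Equiv.mulLeft π₀).trans (Equiv.arrowCongr σ₀ (Equiv.refl _))).prodCongr
    (Equiv.mulLeft σ₀), fun κ => ?_⟩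
  ext ⟨j, t⟩
  rw [Positions.mem_permuted, Positions.mem_permuted]
  simpa [twoStageIdx] using (h₀ (κ.2 j) (κ.1 (κ.2 j) t)).symm

section Tuples

variable {F : Type*} [Field F] {ℓ : ℕ} {comb comb' : (Fin ℓ → F) → F → F}
  {σ σ' : Equiv.Perm (Sub B m)} {x x' : Positions B m K} {δ δ' : Values F ℓ K} {u u' : Fin K → F}

theorem sparseUpdate_eq_zero {s : Sub B m} (h : s ∉ x.1) (δ : Values F ℓ K) :
    sparseUpdate x δ s = 0 :=
  funext fun _ => Finset.sum_eq_zero fun i _ =>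
    if_neg fun hi => h ((x.mem_iff_exists_nth s).2 ⟨i, hi⟩)

theorem updateVector_tuples (hcomb : comb 0 0 = 0) (σ : Equiv.Perm (Sub B m)) (u : Fin K → F)
    (x : Positions B m K) (δ : Values F ℓ K) (s : Sub B m) :
    updateVector (tuples comb σ u x δ) s = comb (sparseUpdate x δ (σ s))
      (∑ i, if (x.permuted σ).nth i = s then u i else 0) := by
  rw [updateVector]
  by_cases h : s ∈ (x.permuted σ).1
  · obtain ⟨i, rfl⟩ := ((x.permuted σ).mem_iff_exists_nth s).1 h
    simp [tuples, (Positions.nth_injective _).eq_iff]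
  · have hnth (i : Fin K) : (x.permuted σ).nth i ≠ s := fun hi =>
      h (((x.permuted σ).mem_iff_exists_nth s).2 ⟨i, hi⟩)
    have hs : σ s ∉ x.1 := mt (x.mem_permuted σ s).2 h
    simp [tuples, hnth, sparseUpdate_eq_zero hs, hcomb]

theorem permuted_eq_of_tuples_eq (h : tuples comb σ u x δ = tuples comb' σ' u' x' δ') :
    x.permuted σ = x'.permuted σ' :=
  Positions.ext_nth <| funext fun i => congrArg Prod.snd (congrFun h i)

theorem segCounts_eq_of_tuples_eq {π π' : Fin B → Equiv.Perm (Fin m)}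
    (h : tuples comb (withinIdx π) u x δ = tuples comb' (withinIdx π') u' x' δ') :
    segCounts x = segCounts x' := by
  rw [← segCounts_permuted_withinIdx π, permuted_eq_of_tuples_eq h, segCounts_permuted_withinIdx]

theorem unorderedCounts_eq_of_tuples_eq {π π' : Fin B → Equiv.Perm (Fin m)}
    {ς ς' : Equiv.Perm (Fin B)}
    (h : tuples comb (twoStageIdx π ς) u x δ = tuples comb' (twoStageIdx π' ς') u' x' δ') :
    unorderedCounts x = unorderedCounts x' := by
  rw [← unorderedCounts_permuted_twoStageIdx π ς, permuted_eq_of_tuples_eq h,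
    unorderedCounts_permuted_twoStageIdx]

end Tuples

end PositionsAndPermutations

section OneTimePads

/-- The encoding `enc w z` of a message `w` with a key `z` hides the message from an observer for
whom the key is uniform: changing the message amounts to permuting the keys. -/
def OneTimePad {W A C : Type*} (enc : W → A → C) : Prop :=
  ∀ w w', ∃ e : A ≃ A, ∀ z, enc w z = enc w' (e z)

namespace OneTimePad

variable {W W' A A' C C' : Type*} {enc : W → A → C}

theorem of_surjective [AddGroup A] [AddCommGroup C] (g : W → C) {L : A → C}
    (hadd : ∀ z z', L (z + z') = L z + L z') (hL : Function.Surjective L) :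
    OneTimePad fun w z => g w + L z := fun w w' => by
  obtain ⟨c, hc⟩ := hL (g w - g w')
  refine ⟨Equiv.addRight c, fun z => ?_⟩
  simp only [Equiv.coe_addRight, hadd, hc]
  abel

theorem prodMap {enc' : W' → A' → C'} (h : OneTimePad enc) (h' : OneTimePad enc') :
    OneTimePad fun (w : W × W') (z : A × A') => (enc w.1 z.1, enc' w.2 z.2) := fun w w' => by
  obtain ⟨e, he⟩ := h w.1 w'.1
  obtain ⟨e', he'⟩ := h' w.2 w'.2
  exact ⟨e.prodCongr e', fun z => Prod.ext (he z.1) (he' z.2)⟩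

theorem piMap {ι : Type*} {W A C : ι → Type*} {enc : ∀ i, W i → A i → C i}
    (h : ∀ i, OneTimePad (enc i)) :
    OneTimePad fun (w : ∀ i, W i) (z : ∀ i, A i) i => enc i (w i) (z i) := by
  intro w w'
  choose e he using fun i => h i (w i) (w' i)
  exact ⟨Equiv.piCongrRight e, fun z => funext fun i => he i (z i)⟩

end OneTimePad

variable {F : Type*} [Field F] {B m ℓ d K : ℕ}

theorem sum_pow_mul_add (a : F) (z z' : Fin d → F) :
    ∑ j : Fin d, a ^ (j : ℕ) * (z + z') j =
      ∑ j : Fin d, a ^ (j : ℕ) * z j + ∑ j : Fin d, a ^ (j : ℕ) * z' j := by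
  simp only [Pi.add_apply, mul_add, Finset.sum_add_distrib]

theorem surjective_sum_pow_mul (a : F) :
    Function.Surjective fun z : Fin (d + 1) → F => ∑ j : Fin (d + 1), a ^ (j : ℕ) * z j :=
  fun c => ⟨Pi.single 0 c, by simp [Fin.sum_univ_succ]⟩

theorem oneTimePad_uncodedSymbol (c a : F) : OneTimePad (uncodedSymbol (d := d + 1) c a) :=
  .of_surjective _ (sum_pow_mul_add a) (surjective_sum_pow_mul a)

theorem oneTimePad_codedSymbol (a : F) : OneTimePad (codedSymbol (ℓ := ℓ) (d := d + 1) a) :=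
  .of_surjective _ (sum_pow_mul_add a) (surjective_sum_pow_mul a)

theorem oneTimePad_uncodedRev (f : Fin ℓ → F) (a : F) : OneTimePad (uncodedRev (m := m) f a) :=
  .of_surjective _ (fun _ _ => rfl) Function.surjective_id

theorem oneTimePad_uncodedInterRev {f : Fin ℓ → F} {a : F} (h : ∀ k, f k ≠ a) :
    OneTimePad (uncodedInterRev (B := B) f a) := by
  refine .of_surjective _ (mul_add _) fun C => ⟨.of fun i j => (f i.2 - a)⁻¹ * C i j, ?_⟩
  ext i j
  rw [← Matrix.diagonal_one, Matrix.diagonal_kronecker_diagonal, Matrix.diagonal_mul, one_mul,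
    Matrix.of_apply, mul_inv_cancel_left₀ (sub_ne_zero.2 (h i.2))]

theorem oneTimePad_codedRev {a : F} (h : a ≠ 0) : OneTimePad (codedRev (b := m) ℓ a) :=
  .of_surjective _ (smul_add _) fun C => ⟨_, smul_inv_smul₀ (pow_ne_zero ℓ h) C⟩

theorem oneTimePad_uncodedComb {f : Fin ℓ → F} {a : F} (h : ∀ k, f k ≠ a) :
    OneTimePad (uncodedComb f a) :=
  .of_surjective _ (mul_add _) <|
    mul_left_surjective₀ <| Finset.prod_ne_zero_iff.2 fun j _ => sub_ne_zero.2 (h j)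

theorem oneTimePad_codedComb (a : F) : OneTimePad (codedComb (ℓ := ℓ) a) :=
  .of_surjective _ (fun _ _ => rfl) Function.surjective_id

theorem exists_equiv_tuples_eq {comb : (Fin ℓ → F) → F → F} (hcomb : OneTimePad comb)
    {σ σ' : Equiv.Perm (Sub B m)} {x x' : Positions B m K} (h : x.permuted σ = x'.permuted σ')
    (δ δ' : Values F ℓ K) :
    ∃ e : (Fin K → F) ≃ (Fin K → F), ∀ u, tuples comb σ u x δ = tuples comb σ' (e u) x' δ' := by
  choose e he using hcomb
  refine ⟨Equiv.piCongrRight fun i => e (sparseUpdate x δ (σ ((x.permuted σ).nth i)))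
    (sparseUpdate x' δ' (σ' ((x.permuted σ).nth i))), fun u => funext fun i => ?_⟩
  simp only [tuples, ← h]
  exact Prod.ext (he _ _ _) rfl

end OneTimePads

namespace Scheme

variable {F : Type u} {N B m ℓ Ku Kd : ℕ} {S : Scheme F N B m ℓ Ku Kd}

/-- The content of each database is a one-time pad encryption of the model and the key. -/
def StorePadded (S : Scheme F N B m ℓ Ku Kd) : Prop :=
  ∀ n, OneTimePad fun (d : Model F B m ℓ × S.Key) z => S.store n d.1 d.2 z

/-- The writing phase updates the model correctly in all databases, and its effect on the noise of
the coordinator is a permutation, so that uniform noise stays uniform. -/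
def WritePadded [Field F] (S : Scheme F N B m ℓ Ku Kd) : Prop :=
  ∀ w k u x δ, ∃ e : S.Noise ≃ S.Noise, ∀ z n,
    S.update n (S.store n w k z) (S.upload n k u x δ) = S.store n (w + sparseUpdate x δ) k (e z)

/-- The key and the noise of the user hide everything but `stat X` in the message to a database:
updates with the same `stat X` are exchanged by permuting the keys and the noise. -/
def UploadHides (S : Scheme F N B m ℓ Ku Kd) {T : Type*} (stat : Positions B m Ku → T) : Prop :=
  ∀ n x x' δ δ', stat x = stat x' → ∃ e : S.Key ≃ S.Key, ∀ k,
    ∃ e' : S.UserNoise ≃ S.UserNoise, ∀ u, S.upload n k u x δ = S.upload n (e k) (e' u) x' δ'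

/-- The message to each database determines `stat X`. -/
def UploadReveals (S : Scheme F N B m ℓ Ku Kd) {T : Type*} (stat : Positions B m Ku → T) : Prop :=
  ∀ n k k' u u' x x' δ δ', S.upload n k u x δ = S.upload n k' u' x' δ' → stat x = stat x'

/-- The law of the key and the noises; `S.law p` is `indepLaw p S.randomness` by definition. -/
noncomputable def randomness (S : Scheme F N B m ℓ Ku Kd) : PMF (S.Key × S.Noise × S.UserNoise) :=
  PMF.uniformOfFintype _

theorem WritePadded.writeCorrect [Field F] (hwrite : S.WritePadded) : S.WriteCorrect :=
  fun w k z u x δ => by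
    obtain ⟨e, he⟩ := hwrite w k u x δ
    exact ⟨e z, he z⟩

theorem StorePadded.condLaw_storeBefore_eq (hstore : S.StorePadded) (n : Fin N)
    (d d' : Data F B m ℓ Ku) :
    condLaw S.randomness (S.storeBefore n) d = condLaw S.randomness (S.storeBefore n) d' := by
  choose E hE using fun k => hstore n (d.1, k) (d'.1, k)
  exact condLaw_uniform_eq_of_equiv (Equiv.prodCongrRight fun k => (E k).prodCongr (.refl _))
    fun ρ => hE ρ.1 ρ.2.1

theorem WritePadded.condLaw_storeAfter_eq [Field F] (hwrite : S.WritePadded) (n : Fin N)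
    (d : Data F B m ℓ Ku) :
    condLaw S.randomness (S.storeAfter n) d =
      condLaw S.randomness (S.storeBefore n) (d.1 + sparseUpdate d.2.1 d.2.2, d.2) := by
  choose E hE using fun k u => hwrite d.1 k u d.2.1 d.2.2
  exact condLaw_uniform_eq_of_equiv
    (Equiv.prodCongrRight fun k => Equiv.prodCongrLeft fun u => E k u)
    fun ρ => hE ρ.1 ρ.2.2 ρ.2.1 n

theorem condLaw_store_sent_eq (hstore : S.StorePadded) {T : Type*} {stat : Positions B m Ku → T}
    (hhides : S.UploadHides stat) (n : Fin N) {d d' : Data F B m ℓ Ku}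
    (h : stat d.2.1 = stat d'.2.1) :
    condLaw S.randomness (fun ω => (S.storeBefore n ω, S.sent n ω)) d =
      condLaw S.randomness (fun ω => (S.storeBefore n ω, S.sent n ω)) d' := by
  obtain ⟨e, he⟩ := hhides n _ _ d.2.2 d'.2.2 h
  choose U hU using he
  choose E hE using fun k => hstore n (d.1, k) (d'.1, e k)
  exact condLaw_uniform_eq_of_equiv (Equiv.prodShear e fun k => (E k).prodCongr (U k))
    fun ρ => Prod.ext (hE ρ.1 ρ.2.1) (hU ρ.1 ρ.2.2)

theorem condLaw_sent_eq {T : Type*} {stat : Positions B m Ku → T} (hhides : S.UploadHides stat)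
    (n : Fin N) {d d' : Data F B m ℓ Ku} (h : stat d.2.1 = stat d'.2.1) :
    condLaw S.randomness (S.sent n) d = condLaw S.randomness (S.sent n) d' := by
  obtain ⟨e, he⟩ := hhides n _ _ d.2.2 d'.2.2 h
  choose U hU using he
  exact condLaw_uniform_eq_of_equiv
    (Equiv.prodShear e fun k => (Equiv.refl S.Noise).prodCongr (U k)) fun ρ => hU ρ.1 ρ.2.2

theorem readCorrect_of_determined [Nonempty F]
    (h : ∀ V w k z w' k' z',
      (∀ n, S.answer n (S.store n w k z) V = S.answer n (S.store n w' k' z') V) →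
      ∀ i, w (S.realIdx k (V i)) = w' (S.realIdx k' (V i))) : S.ReadCorrect := by
  let subpackets (V : Fin Kd → Sub B m) (a : Model F B m ℓ × S.Key × S.Noise) :
      Fin Kd → Fin ℓ → F := fun i => a.1 (S.realIdx a.2.1 (V i))
  let answers (V : Fin Kd → Sub B m) (a : Model F B m ℓ × S.Key × S.Noise) : Fin N → S.Answer :=
    fun n => S.answer n (S.store n a.1 a.2.1 a.2.2) V
  have hfactors (V) : (subpackets V).FactorsThrough (answers V) := fun a a' ha =>
    funext fun i => h V _ _ _ _ _ _ (congrFun ha) i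
  choose dec hdec using fun V => (Function.factorsThrough_iff _).1 (hfactors V)
  exact ⟨dec, fun w k z V => (congrFun (hdec V) (w, k, z)).symm⟩

variable [Finite F]

theorem secure_of_padded [Field F] (hstore : S.StorePadded) (hwrite : S.WritePadded) :
    S.Secure := fun p n =>
  ⟨mutualInfo_indepLaw_eq_zero p S.randomness (fun d => d.1) (S.storeBefore n)
      (hstore.condLaw_storeBefore_eq n),
    mutualInfo_indepLaw_eq_zero p S.randomness (fun d => d.1 + sparseUpdate d.2.1 d.2.2)
      (S.storeAfter n) fun d d' => by
        rw [hwrite.condLaw_storeAfter_eq, hwrite.condLaw_storeAfter_eq,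
          hstore.condLaw_storeBefore_eq]⟩

theorem valuesPrivate_of_padded (hstore : S.StorePadded) {T : Type*}
    {stat : Positions B m Ku → T} (hhides : S.UploadHides stat) : S.ValuesPrivate := fun p n =>
  ⟨condMutualInfo_indepLaw_eq_zero p S.randomness (fun d => d.2.2) (fun d => d.2.1)
      (fun ω => (S.storeBefore n ω, S.sent n ω))
      fun _ _ h => condLaw_store_sent_eq hstore hhides n (congrArg stat h),
    fun _ φ => mutualInfo_indepLaw_eq_zero_of_mutualInfo_eq_zero p S.randomness
      (fun d => φ d.2.2) (fun d => d.2.1) (S.sent n)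
      fun _ _ h => condLaw_sent_eq hhides n (congrArg stat h)⟩

theorem positionLeakage_of_padded (hstore : S.StorePadded) {T : Type*}
    {stat : Positions B m Ku → T} (hhides : S.UploadHides stat)
    (hreveals : S.UploadReveals stat) : S.PositionLeakage stat := fun p n => by
  have hsent (ω ω' : S.Sample) (h : S.sent n ω = S.sent n ω') :
      stat (S.positions ω) = stat (S.positions ω') := hreveals n _ _ _ _ _ _ _ _ h
  exact ⟨mutualInfo_indepLaw_eq_entropy p S.randomness (fun d => d.2.1) (S.sent n) stat
      (fun _ _ => condLaw_sent_eq hhides n) hsent,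
    mutualInfo_indepLaw_eq_entropy p S.randomness (fun d => d.2.1)
      (fun ω => (S.storeBefore n ω, S.sent n ω)) stat
      (fun _ _ => condLaw_store_sent_eq hstore hhides n)
      fun ω ω' h => hsent ω ω' (Prod.ext_iff.1 h).2⟩

end Scheme

section UpdatedSymbols

variable {F ι T : Type*} [Field F] [Fintype T] [DecidableEq T] {α : ι → F} {τ : Equiv.Perm T}
  {ℓ d e : ℕ}

theorem uncodedComb_zero (f : Fin ℓ → F) (a : F) : uncodedComb f a 0 0 = 0 := by
  simp [uncodedComb]

theorem codedComb_zero (a : F) : codedComb (ℓ := ℓ) a 0 0 = 0 := by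
  simp [codedComb]

theorem exists_uncodedSymbol_add_increment_eq {f : Fin ℓ → F}
    {A : ι → Matrix (T × Fin ℓ) (T × Fin ℓ) F} (hf : Function.Injective f)
    (hfα : ∀ k n, f k ≠ α n)
    (hA : ∀ k, IsNoisyReversing α (fun n => f k - α n) e τ fun n => collapse f (α n) (A n) k)
    (Δ : T → Fin ℓ → F) (u : T → F) (s : T) (k : Fin ℓ) :
    ∃ c : Fin (ℓ + e + 1) → F, ∀ n w z, uncodedSymbol (f k) (α n) w z +
        (A n).mulVec (fun b => uncodedComb f (α n) (Δ (τ b.1)) (u b.1)) (s, k) =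
      uncodedSymbol (f k) (α n) (w + Δ s k) (z + c) := by
  cases ℓ with
  | zero => exact k.elim0
  | succ ℓ =>
    obtain ⟨c, hc⟩ := mem_polyFun_iff_exists_coeff.1
      (uncoded_increment_sub_mem_polyFun hf hfα hA Δ u s k)
    refine ⟨c, fun n w z => ?_⟩
    rw [uncodedSymbol, uncodedSymbol, sum_pow_mul_add, ← hc]
    ring

theorem exists_codedSymbol_add_increment_eq {A : ι → T → T → F} (hα₀ : ∀ n, α n ≠ 0)
    (hA : IsNoisyReversing α (fun n => α n ^ ℓ) e τ A) (hd : ℓ + e ≤ d) (Δ : T → Fin ℓ → F)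
    (u : T → F) (s : T) :
    ∃ c : Fin (d + 1) → F, ∀ n w z, codedSymbol (α n) w z +
        ∑ t, A n s t * codedComb (α n) (Δ (τ t)) (u t) =
      codedSymbol (α n) (w + Δ s) (z + c) := by
  obtain ⟨c, hc⟩ := mem_polyFun_iff_exists_coeff.1
    (polyFun_mono hd (coded_increment_sub_mem_polyFun hα₀ hA Δ u s))
  refine ⟨c, fun n w z => ?_⟩
  simp only [codedSymbol, ← hc, originPole, Pi.add_apply, mul_add,
    Finset.sum_add_distrib]
  ring

end UpdatedSymbols

section UncodedSchemes

variable {F : Type u} [Field F] [Fintype F] {N B m ℓ Ku Kd : ℕ} {f : Fin ℓ → F} {α : Fin N → F}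

theorem scheme1_storePadded : (scheme1 f α B m Ku Kd).StorePadded := fun n =>
  .prodMap (.piMap fun _ => .piMap fun k => oneTimePad_uncodedSymbol (f k) (α n))
    (.piMap fun _ => oneTimePad_uncodedRev f (α n))

theorem scheme3_storePadded (hfα : ∀ k n, f k ≠ α n) : (scheme3 f α B m Ku Kd).StorePadded :=
  fun n => .prodMap (.piMap fun _ => .piMap fun k => oneTimePad_uncodedSymbol (f k) (α n))
    (.prodMap (.piMap fun _ => oneTimePad_uncodedRev f (α n))
      (oneTimePad_uncodedInterRev fun k => hfα k n))

theorem scheme1_writePadded (hf : Function.Injective f) (hfα : ∀ k n, f k ≠ α n) :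
    (scheme1 f α B m Ku Kd).WritePadded := by
  intro w π u x δ
  let v : Sub B m → F := fun s => ∑ i, if (x.permuted (withinIdx π)).nth i = s then u i else 0
  choose c hc using fun (Z : Fin B → Matrix (Fin m × Fin ℓ) (Fin m × Fin ℓ) F) (s : Sub B m) =>
    exists_uncodedSymbol_add_increment_eq hf hfα
      (isNoisyReversing_collapse_uncodedRev hfα (π s.1) (Z s.1))
      (fun t => sparseUpdate x δ (s.1, t)) (fun t => v (s.1, t)) s.2
  refine ⟨Equiv.prodCongrLeft fun Z => Equiv.addRight (c Z), fun z n =>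
    Prod.ext (funext₂ fun s k => ?_) rfl⟩
  refine Eq.trans ?_ (hc z.2 s k n (w s k) (z.1 s k))
  have hupdate := updateVector_tuples (uncodedComb_zero f (α n)) (withinIdx π) u x δ
  simp only [scheme1, hupdate]
  rfl

theorem scheme3_writePadded (hf : Function.Injective f) (hfα : ∀ k n, f k ≠ α n) :
    (scheme3 f α B m Ku Kd).WritePadded := by
  intro w κ u x δ
  let v : Sub B m → F :=
    fun s => ∑ i, if (x.permuted (twoStageIdx κ.1 κ.2)).nth i = s then u i else 0
  choose c hc using fun (Z : (Fin B → Matrix (Fin m × Fin ℓ) (Fin m × Fin ℓ) F) ×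
      Matrix (Fin B × Fin ℓ) (Fin B × Fin ℓ) F) =>
    exists_uncodedSymbol_add_increment_eq hf hfα
      (isNoisyReversing_collapse_uncodedCombined hfα κ.1 κ.2 Z.1 Z.2) (sparseUpdate x δ) v
  refine ⟨Equiv.prodCongrLeft fun Z => Equiv.addRight (c Z), fun z n =>
    Prod.ext (funext₂ fun s k => ?_) rfl⟩
  refine Eq.trans ?_ (hc z.2 s k n (w s k) (z.1 s k))
  have hupdate := updateVector_tuples (uncodedComb_zero f (α n)) (twoStageIdx κ.1 κ.2) u x δ
  simp only [scheme3, hupdate]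
  rfl

theorem scheme1_uploadHides (hfα : ∀ k n, f k ≠ α n) :
    (scheme1 f α B m Ku Kd).UploadHides segCounts := fun n _ _ δ δ' h =>
  (exists_withinIdx_equiv h).imp fun _ he π =>
    exists_equiv_tuples_eq (oneTimePad_uncodedComb fun k => hfα k n) (he π) δ δ'

theorem scheme3_uploadHides (hfα : ∀ k n, f k ≠ α n) :
    (scheme3 f α B m Ku Kd).UploadHides unorderedCounts := fun n _ _ δ δ' h =>
  (exists_twoStageIdx_equiv h).imp fun _ he κ =>
    exists_equiv_tuples_eq (oneTimePad_uncodedComb fun k => hfα k n) (he κ) δ δ'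

theorem scheme1_uploadReveals : (scheme1 f α B m Ku Kd).UploadReveals segCounts :=
  fun _ _ _ _ _ _ _ _ _ => segCounts_eq_of_tuples_eq

theorem scheme3_uploadReveals : (scheme3 f α B m Ku Kd).UploadReveals unorderedCounts :=
  fun _ _ _ _ _ _ _ _ _ => unorderedCounts_eq_of_tuples_eq

theorem scheme1_answer_sub_simplePoles_mem_polyFun (hfα : ∀ k n, f k ≠ α n) (w : Model F B m ℓ)
    (π : Fin B → Equiv.Perm (Fin m)) (z : (scheme1 f α B m Ku Kd).Noise) (V : Fin Kd → Sub B m)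
    (i : Fin Kd) :
    (fun n => (scheme1 f α B m Ku Kd).answer n ((scheme1 f α B m Ku Kd).store n w π z) V i -
      simplePoles f (α n) (w (withinIdx π (V i)))) ∈ polyFun α (1 + ℓ + 0) := by
  have hanswer := uncoded_answer_sub_mem_polyFun hfα
    (isNoisyReversing_collapse_uncodedRev hfα (π (V i).1) (z.2 (V i).1))
    (w := fun s => w ((V i).1, s))
    (fun s k => uncodedSymbol_sub_mem_polyFun (f k) _ (z.1 ((V i).1, s) k)) (V i).2
  simp only [collapse, mul_left_comm (uncodedSymbol _ _ _ _), ← mul_assoc] at hanswer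
  exact hanswer

theorem scheme3_answer_sub_simplePoles_mem_polyFun (hfα : ∀ k n, f k ≠ α n) (w : Model F B m ℓ)
    (κ : (Fin B → Equiv.Perm (Fin m)) × Equiv.Perm (Fin B))
    (z : (scheme3 f α B m Ku Kd).Noise) (V : Fin Kd → Sub B m) (i : Fin Kd) :
    (fun n => (scheme3 f α B m Ku Kd).answer n ((scheme3 f α B m Ku Kd).store n w κ z) V i -
      simplePoles f (α n) (w (twoStageIdx κ.1 κ.2 (V i)))) ∈ polyFun α (1 + (ℓ + 1) + 1) :=
  uncoded_answer_sub_mem_polyFun hfα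
    (isNoisyReversing_collapse_uncodedCombined hfα κ.1 κ.2 z.2.1 z.2.2)
    (fun s k => uncodedSymbol_sub_mem_polyFun (f k) (w s k) (z.1 s k)) (V i)

theorem scheme1_readCorrect (hf : Function.Injective f) (hα : Function.Injective α)
    (hfα : ∀ k n, f k ≠ α n) (hN : 2 * ℓ + 2 ≤ N) : (scheme1 f α B m Ku Kd).ReadCorrect :=
  Scheme.readCorrect_of_determined fun V w π z w' π' z' h i =>
    eq_of_sub_simplePoles_mem_polyFun hf hα hfα (by rw [Fintype.card_fin]; omega)
      (scheme1_answer_sub_simplePoles_mem_polyFun hfα w π z V i)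
      (by
        simp only [h]
        exact scheme1_answer_sub_simplePoles_mem_polyFun hfα w' π' z' V i)

theorem scheme3_readCorrect (hf : Function.Injective f) (hα : Function.Injective α)
    (hfα : ∀ k n, f k ≠ α n) (hN : 2 * ℓ + 4 ≤ N) : (scheme3 f α B m Ku Kd).ReadCorrect :=
  Scheme.readCorrect_of_determined fun V w κ z w' κ' z' h i =>
    eq_of_sub_simplePoles_mem_polyFun hf hα hfα (by rw [Fintype.card_fin]; omega)
      (scheme3_answer_sub_simplePoles_mem_polyFun hfα w κ z V i)
      (by
        simp only [h]
        exact scheme3_answer_sub_simplePoles_mem_polyFun hfα w' κ' z' V i)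

end UncodedSchemes

section CodedSchemes

variable {F : Type u} [Field F] [Fintype F] {N B m ℓ Ku Kd : ℕ} {α : Fin N → F}

theorem scheme2_storePadded (hα₀ : ∀ n, α n ≠ 0) : (scheme2 α B m ℓ Ku Kd).StorePadded :=
  fun n => .prodMap (.piMap fun _ => oneTimePad_codedSymbol (α n))
    (.piMap fun _ => oneTimePad_codedRev (hα₀ n))

theorem scheme4_storePadded (hα₀ : ∀ n, α n ≠ 0) : (scheme4 α B m ℓ Ku Kd).StorePadded :=
  fun n => .prodMap (.piMap fun _ => oneTimePad_codedSymbol (α n))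
    (.prodMap (.piMap fun _ => oneTimePad_codedRev (hα₀ n)) (oneTimePad_codedRev (hα₀ n)))

theorem scheme2_writePadded (hα₀ : ∀ n, α n ≠ 0) : (scheme2 α B m ℓ Ku Kd).WritePadded := by
  intro w π u x δ
  let v : Sub B m → F := fun s => ∑ i, if (x.permuted (withinIdx π)).nth i = s then u i else 0
  choose c hc using fun (Z : Fin B → Matrix (Fin m) (Fin m) F) (s : Sub B m) =>
    exists_codedSymbol_add_increment_eq hα₀ (isNoisyReversing_codedRev (π s.1) (Z s.1))
      (Nat.add_zero ℓ).le (fun t => sparseUpdate x δ (s.1, t)) (fun t => v (s.1, t)) s.2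
  refine ⟨Equiv.prodCongrLeft fun Z => Equiv.addRight (c Z), fun z n =>
    Prod.ext (funext fun s => ?_) rfl⟩
  refine Eq.trans ?_ (hc z.2 s n (w s) (z.1 s))
  have hupdate := updateVector_tuples (codedComb_zero (α n)) (withinIdx π) u x δ
  simp only [scheme2, hupdate]
  rfl

theorem scheme4_writePadded (hα₀ : ∀ n, α n ≠ 0) : (scheme4 α B m ℓ Ku Kd).WritePadded := by
  intro w κ u x δ
  let v : Sub B m → F :=
    fun s => ∑ i, if (x.permuted (twoStageIdx κ.1 κ.2)).nth i = s then u i else 0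
  choose c hc using fun (Z : (Fin B → Matrix (Fin m) (Fin m) F) × Matrix (Fin B) (Fin B) F) =>
    exists_codedSymbol_add_increment_eq hα₀ (isNoisyReversing_codedCombined κ.1 κ.2 Z.1 Z.2)
      (two_mul ℓ).ge (sparseUpdate x δ) v
  refine ⟨Equiv.prodCongrLeft fun Z => Equiv.addRight (c Z), fun z n =>
    Prod.ext (funext fun s => ?_) rfl⟩
  refine Eq.trans ?_ (hc z.2 s n (w s) (z.1 s))
  have hupdate := funext (updateVector_tuples (codedComb_zero (α n)) (twoStageIdx κ.1 κ.2) u x δ)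
  simp only [scheme4, hupdate]
  rfl

theorem scheme2_uploadHides : (scheme2 α B m ℓ Ku Kd).UploadHides segCounts :=
  fun n _ _ δ δ' h => (exists_withinIdx_equiv h).imp fun _ he π =>
    exists_equiv_tuples_eq (oneTimePad_codedComb (α n)) (he π) δ δ'

theorem scheme4_uploadHides : (scheme4 α B m ℓ Ku Kd).UploadHides unorderedCounts :=
  fun n _ _ δ δ' h => (exists_twoStageIdx_equiv h).imp fun _ he κ =>
    exists_equiv_tuples_eq (oneTimePad_codedComb (α n)) (he κ) δ δ'

theorem scheme2_uploadReveals : (scheme2 α B m ℓ Ku Kd).UploadReveals segCounts :=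
  fun _ _ _ _ _ _ _ _ _ => segCounts_eq_of_tuples_eq

theorem scheme4_uploadReveals : (scheme4 α B m ℓ Ku Kd).UploadReveals unorderedCounts :=
  fun _ _ _ _ _ _ _ _ _ => unorderedCounts_eq_of_tuples_eq

theorem scheme2_answer_sub_originPole_mem_polyFun (hα₀ : ∀ n, α n ≠ 0) (w : Model F B m ℓ)
    (π : Fin B → Equiv.Perm (Fin m)) (z : (scheme2 α B m ℓ Ku Kd).Noise) (V : Fin Kd → Sub B m)
    (i : Fin Kd) :
    (fun n => (scheme2 α B m ℓ Ku Kd).answer n ((scheme2 α B m ℓ Ku Kd).store n w π z) V i -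
      originPole (α n) (w (withinIdx π (V i)))) ∈ polyFun α (ℓ + ℓ + 0) :=
  coded_answer_sub_mem_polyFun hα₀ (isNoisyReversing_codedRev (π (V i).1) (z.2 (V i).1))
    (w := fun s => w ((V i).1, s))
    (fun s => codedSymbol_sub_mem_polyFun _ (z.1 ((V i).1, s))) (V i).2

theorem scheme4_answer_sub_originPole_mem_polyFun (hα₀ : ∀ n, α n ≠ 0) (w : Model F B m ℓ)
    (κ : (Fin B → Equiv.Perm (Fin m)) × Equiv.Perm (Fin B))
    (z : (scheme4 α B m ℓ Ku Kd).Noise) (V : Fin Kd → Sub B m) (i : Fin Kd) :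
    (fun n => (scheme4 α B m ℓ Ku Kd).answer n ((scheme4 α B m ℓ Ku Kd).store n w κ z) V i -
      originPole (α n) (w (twoStageIdx κ.1 κ.2 (V i)))) ∈ polyFun α (ℓ + 2 * ℓ + ℓ) :=
  coded_answer_sub_mem_polyFun hα₀ (isNoisyReversing_codedCombined κ.1 κ.2 z.2.1 z.2.2)
    (fun s => codedSymbol_sub_mem_polyFun (w s) (z.1 s)) (V i)

theorem scheme2_readCorrect (hα : Function.Injective α) (hα₀ : ∀ n, α n ≠ 0)
    (hN : 3 * ℓ + 1 ≤ N) : (scheme2 α B m ℓ Ku Kd).ReadCorrect :=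
  Scheme.readCorrect_of_determined fun V w π z w' π' z' h i =>
    eq_of_sub_originPole_mem_polyFun hα hα₀ (by rw [Fintype.card_fin]; omega)
      (scheme2_answer_sub_originPole_mem_polyFun hα₀ w π z V i)
      (by
        simp only [h]
        exact scheme2_answer_sub_originPole_mem_polyFun hα₀ w' π' z' V i)

theorem scheme4_readCorrect (hα : Function.Injective α) (hα₀ : ∀ n, α n ≠ 0)
    (hN : 5 * ℓ + 1 ≤ N) : (scheme4 α B m ℓ Ku Kd).ReadCorrect :=
  Scheme.readCorrect_of_determined fun V w κ z w' κ' z' h i =>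
    eq_of_sub_originPole_mem_polyFun hα hα₀ (by rw [Fintype.card_fin]; omega)
      (scheme4_answer_sub_originPole_mem_polyFun hα₀ w κ z V i)
      (by
        simp only [h]
        exact scheme4_answer_sub_originPole_mem_polyFun hα₀ w' κ' z' V i)

end CodedSchemes

section Costs

variable {F : Type u} [Fintype F] {N B m ℓ Ku Kd K : ℕ}

theorem symbols_prod (F A A' : Type*) [Fintype F] [Fintype A] [Fintype A'] [Nonempty A]
    [Nonempty A'] : Scheme.symbols F (A × A') = Scheme.symbols F A + Scheme.symbols F A' := by
  rw [Scheme.symbols, Fintype.card_prod, Nat.cast_mul]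
  exact Real.logb_mul (Nat.cast_ne_zero.2 Fintype.card_ne_zero)
    (Nat.cast_ne_zero.2 Fintype.card_ne_zero)

theorem symbols_fun (F ι A : Type*) [Fintype F] [Fintype ι] [DecidableEq ι] [Fintype A] :
    Scheme.symbols F (ι → A) = Fintype.card ι * Scheme.symbols F A := by
  rw [Scheme.symbols, Fintype.card_fun, Nat.cast_pow, Real.logb_pow, Scheme.symbols]

theorem symbols_matrix (F ι κ A : Type*) [Fintype F] [Fintype ι] [Fintype κ] [DecidableEq ι]
    [DecidableEq κ] [Fintype A] :
    Scheme.symbols F (Matrix ι κ A) = Fintype.card ι * (Fintype.card κ * Scheme.symbols F A) := by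
  rw [← symbols_fun F κ A, ← symbols_fun F ι (κ → A)]
  rfl

theorem symbols_self (F : Type*) [Fintype F] [Nontrivial F] : Scheme.symbols F F = 1 :=
  Real.logb_self_eq_one (Nat.one_lt_cast.2 Fintype.one_lt_card)

theorem symbols_sub (F : Type*) [Fintype F] (B m : ℕ) :
    Scheme.symbols F (Sub B m) = Real.logb (Fintype.card F) (B * m : ℕ) := by
  simp [Scheme.symbols]

theorem symbols_fin_fun_self [Nontrivial F] : Scheme.symbols F (Fin K → F) = K := by
  rw [symbols_fun, symbols_self, Fintype.card_fin, mul_one]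

theorem symbols_tuples [Nontrivial F] (hP : B * m ≠ 0) :
    Scheme.symbols F (Tuples F B m K) =
      K * (1 + Real.logb (Fintype.card F) (B * m : ℕ)) := by
  have : NeZero B := ⟨left_ne_zero_of_mul hP⟩
  have : NeZero m := ⟨right_ne_zero_of_mul hP⟩
  rw [symbols_fun, symbols_prod, symbols_self, symbols_sub, Fintype.card_fin]

namespace Scheme

variable {S : Scheme F N B m ℓ Ku Kd} {c a r r' : ℝ}

theorem readingCost_eq (hanswer : symbols F S.Answer = Kd) (hP : B * m ≠ 0) (hℓ : ℓ ≠ 0)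
    (hc : c ≠ 0) (hN₀ : (N : ℝ) ≠ 0) (hN : (N : ℝ) = c * ℓ + a)
    (hKd : (Kd : ℝ) = (B * m : ℕ) * r') :
    S.readingCost =
      c * r' * (1 + Real.logb (Fintype.card F) (B * m : ℕ) / N) / (1 - a / N) := by
  have hrate : 1 - a / N = c * ℓ / N := by rw [one_sub_div hN₀, hN, add_sub_cancel_right]
  rw [readingCost, hanswer, symbols_fun, symbols_sub, hrate, Fin.sum_const, Fintype.card_fin,
    nsmul_eq_mul, hKd, Nat.cast_mul (B * m) ℓ]
  field_simp

theorem writingCost_eq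
    (hupload : symbols F S.Upload = Ku * (1 + Real.logb (Fintype.card F) (B * m : ℕ)))
    (hP : B * m ≠ 0) (hℓ : ℓ ≠ 0) (hc : c ≠ 0) (hN₀ : (N : ℝ) ≠ 0) (hN : (N : ℝ) = c * ℓ + a)
    (hKu : (Ku : ℝ) = (B * m : ℕ) * r) :
    S.writingCost = c * r * (1 + Real.logb (Fintype.card F) (B * m : ℕ)) / (1 - a / N) := by
  have hrate : 1 - a / N = c * ℓ / N := by rw [one_sub_div hN₀, hN, add_sub_cancel_right]
  rw [writingCost, hupload, hrate, Fin.sum_const, nsmul_eq_mul, hKu, Nat.cast_mul (B * m) ℓ]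
  field_simp

theorem achieves_of_padded [Field F] {T : Type*} {stat : Positions B m Ku → T} {CR CW : ℝ}
    (hread : S.ReadCorrect) (hstore : S.StorePadded) (hwrite : S.WritePadded)
    (hhides : S.UploadHides stat) (hreveals : S.UploadReveals stat) (hCR : S.readingCost = CR)
    (hCW : S.writingCost = CW) : S.Achieves stat CR CW where
  readCorrect := hread
  writeCorrect := hwrite.writeCorrect
  secure := secure_of_padded hstore hwrite
  valuesPrivate := valuesPrivate_of_padded hstore hhides
  positionLeakage := positionLeakage_of_padded hstore hhides hreveals
  readingCost_eq := hCR
  writingCost_eq := hCW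

end Scheme

end Costs

section Achievability

variable {F : Type u} [Field F] [Fintype F] {N B m ℓ Ku Kd : ℕ} {f : Fin ℓ → F} {α : Fin N → F}
  {r r' : ℝ}

theorem scheme1_achieves (hf : Function.Injective f) (hα : Function.Injective α)
    (hfα : ∀ k n, f k ≠ α n) (hP : B * m ≠ 0) (hℓ : ℓ ≠ 0) (hN : N = 2 * ℓ + 2)
    (hKu : (Ku : ℝ) = (B * m : ℕ) * r) (hKd : (Kd : ℝ) = (B * m : ℕ) * r') :
    (scheme1 f α B m Ku Kd).Achieves segCounts
      (2 * r' * (1 + Real.logb (Fintype.card F) (B * m : ℕ) / N) / (1 - 2 / N))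
      (2 * r * (1 + Real.logb (Fintype.card F) (B * m : ℕ)) / (1 - 2 / N)) := by
  have hN₀ : (N : ℝ) ≠ 0 := Nat.cast_ne_zero.2 (by omega)
  have hN' : (N : ℝ) = 2 * ℓ + 2 := mod_cast hN
  exact Scheme.achieves_of_padded (scheme1_readCorrect hf hα hfα hN.ge) scheme1_storePadded
    (scheme1_writePadded hf hfα) (scheme1_uploadHides hfα) scheme1_uploadReveals
    (Scheme.readingCost_eq symbols_fin_fun_self hP hℓ two_ne_zero hN₀ hN' hKd)
    (Scheme.writingCost_eq (symbols_tuples hP) hP hℓ two_ne_zero hN₀ hN' hKu)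

theorem scheme2_achieves (hα : Function.Injective α) (hα₀ : ∀ n, α n ≠ 0) (hP : B * m ≠ 0)
    (hℓ : ℓ ≠ 0) (hN : N = 3 * ℓ + 1) (hKu : (Ku : ℝ) = (B * m : ℕ) * r)
    (hKd : (Kd : ℝ) = (B * m : ℕ) * r') :
    (scheme2 α B m ℓ Ku Kd).Achieves segCounts
      (3 * r' * (1 + Real.logb (Fintype.card F) (B * m : ℕ) / N) / (1 - 1 / N))
      (3 * r * (1 + Real.logb (Fintype.card F) (B * m : ℕ)) / (1 - 1 / N)) := by
  have hN₀ : (N : ℝ) ≠ 0 := Nat.cast_ne_zero.2 (by omega)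
  have hN' : (N : ℝ) = 3 * ℓ + 1 := mod_cast hN
  exact Scheme.achieves_of_padded (scheme2_readCorrect hα hα₀ hN.ge) (scheme2_storePadded hα₀)
    (scheme2_writePadded hα₀) scheme2_uploadHides scheme2_uploadReveals
    (Scheme.readingCost_eq symbols_fin_fun_self hP hℓ three_ne_zero hN₀ hN' hKd)
    (Scheme.writingCost_eq (symbols_tuples hP) hP hℓ three_ne_zero hN₀ hN' hKu)

theorem scheme3_achieves (hf : Function.Injective f) (hα : Function.Injective α)
    (hfα : ∀ k n, f k ≠ α n) (hP : B * m ≠ 0) (hℓ : ℓ ≠ 0) (hN : N = 2 * ℓ + 4)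
    (hKu : (Ku : ℝ) = (B * m : ℕ) * r) (hKd : (Kd : ℝ) = (B * m : ℕ) * r') :
    (scheme3 f α B m Ku Kd).Achieves unorderedCounts
      (2 * r' * (1 + Real.logb (Fintype.card F) (B * m : ℕ) / N) / (1 - 4 / N))
      (2 * r * (1 + Real.logb (Fintype.card F) (B * m : ℕ)) / (1 - 4 / N)) := by
  have hN₀ : (N : ℝ) ≠ 0 := Nat.cast_ne_zero.2 (by omega)
  have hN' : (N : ℝ) = 2 * ℓ + 4 := mod_cast hN
  exact Scheme.achieves_of_padded (scheme3_readCorrect hf hα hfα hN.ge) (scheme3_storePadded hfα)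
    (scheme3_writePadded hf hfα) (scheme3_uploadHides hfα) scheme3_uploadReveals
    (Scheme.readingCost_eq symbols_fin_fun_self hP hℓ two_ne_zero hN₀ hN' hKd)
    (Scheme.writingCost_eq (symbols_tuples hP) hP hℓ two_ne_zero hN₀ hN' hKu)

theorem scheme4_achieves (hα : Function.Injective α) (hα₀ : ∀ n, α n ≠ 0) (hP : B * m ≠ 0)
    (hℓ : ℓ ≠ 0) (hN : N = 5 * ℓ + 1) (hKu : (Ku : ℝ) = (B * m : ℕ) * r)
    (hKd : (Kd : ℝ) = (B * m : ℕ) * r') :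
    (scheme4 α B m ℓ Ku Kd).Achieves unorderedCounts
      (5 * r' * (1 + Real.logb (Fintype.card F) (B * m : ℕ) / N) / (1 - 1 / N))
      (5 * r * (1 + Real.logb (Fintype.card F) (B * m : ℕ)) / (1 - 1 / N)) := by
  have hN₀ : (N : ℝ) ≠ 0 := Nat.cast_ne_zero.2 (by omega)
  have hN' : (N : ℝ) = 5 * ℓ + 1 := mod_cast hN
  exact Scheme.achieves_of_padded (scheme4_readCorrect hα hα₀ hN.ge) (scheme4_storePadded hα₀)
    (scheme4_writePadded hα₀) scheme4_uploadHides scheme4_uploadReveals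
    (Scheme.readingCost_eq symbols_fin_fun_self hP hℓ (by norm_num) hN₀ hN' hKd)
    (Scheme.writingCost_eq (symbols_tuples hP) hP hℓ (by norm_num) hN₀ hN' hKu)

end Achievability

section Storage

variable {F : Type u} [Field F] [Fintype F] {N B m ℓ Ku Kd : ℕ} {f : Fin ℓ → F} {α : Fin N → F}

theorem scheme1_storageSize :
    (scheme1 f α B m Ku Kd).storageSize = B * (m * ℓ + (m * ℓ) ^ 2) := by
  have hsize : (scheme1 f α B m Ku Kd).storageSize = Scheme.symbols F
    ((Sub B m → Fin ℓ → F) × (Fin B → Matrix (Fin m × Fin ℓ) (Fin m × Fin ℓ) F)) := rfl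
  simp only [hsize, symbols_prod, symbols_fun, symbols_matrix, symbols_self, Fintype.card_prod,
    Fintype.card_fin, Nat.cast_mul]
  ring

theorem scheme2_storageSize : (scheme2 α B m ℓ Ku Kd).storageSize = B * (m + m ^ 2) := by
  have hsize : (scheme2 α B m ℓ Ku Kd).storageSize =
    Scheme.symbols F ((Sub B m → F) × (Fin B → Matrix (Fin m) (Fin m) F)) := rfl
  simp only [hsize, symbols_prod, symbols_fun, symbols_matrix, symbols_self, Fintype.card_prod,
    Fintype.card_fin, Nat.cast_mul]
  ring

theorem scheme3_storageSize :
    (scheme3 f α B m Ku Kd).storageSize = B * (m * ℓ + (m * ℓ) ^ 2) + (B * ℓ) ^ 2 := by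
  have hsize : (scheme3 f α B m Ku Kd).storageSize = Scheme.symbols F
    ((Sub B m → Fin ℓ → F) × (Fin B → Matrix (Fin m × Fin ℓ) (Fin m × Fin ℓ) F) ×
      Matrix (Fin B × Fin ℓ) (Fin B × Fin ℓ) F) := rfl
  simp only [hsize, symbols_prod, symbols_fun, symbols_matrix, symbols_self, Fintype.card_prod,
    Fintype.card_fin, Nat.cast_mul]
  ring

theorem scheme4_storageSize : (scheme4 α B m ℓ Ku Kd).storageSize = B * (m + m ^ 2) + B ^ 2 := by
  have hsize : (scheme4 α B m ℓ Ku Kd).storageSize = Scheme.symbols F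
    ((Sub B m → F) × (Fin B → Matrix (Fin m) (Fin m) F) × Matrix (Fin B) (Fin B) F) := rfl
  simp only [hsize, symbols_prod, symbols_fun, symbols_matrix, symbols_self, Fintype.card_prod,
    Fintype.card_fin, Nat.cast_mul]
  ring

theorem uncoded_size_le (hP : B * m ≠ 0) (hℓ : ℓ ≠ 0) :
    (B * (m * ℓ + (m * ℓ) ^ 2) : ℝ) ≤ 2 * (((B * m * ℓ : ℕ) : ℝ) ^ 2 / B) := by
  have hB : (B : ℝ) ≠ 0 := Nat.cast_ne_zero.2 (left_ne_zero_of_mul hP)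
  have hmℓ : (1 : ℝ) ≤ m * ℓ :=
    mod_cast Nat.one_le_iff_ne_zero.2 (mul_ne_zero (right_ne_zero_of_mul hP) hℓ)
  calc (B * (m * ℓ + (m * ℓ) ^ 2) : ℝ) ≤ B * ((m * ℓ) ^ 2 + (m * ℓ) ^ 2) := by
        gcongr
        exact le_self_pow₀ hmℓ two_ne_zero
    _ = 2 * (((B * m * ℓ : ℕ) : ℝ) ^ 2 / B) := by
        push_cast
        field_simp
        ring

theorem coded_size_le {c : ℝ} (hP : B * m ≠ 0) (hN₀ : N ≠ 0) (hN : (N : ℝ) ≤ c * ℓ) :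
    (B * (m + m ^ 2) : ℝ) ≤
      2 * c ^ 2 * (((B * m * ℓ : ℕ) : ℝ) ^ 2 / (B * (N : ℝ) ^ 2)) := by
  have hB : (B : ℝ) ≠ 0 := Nat.cast_ne_zero.2 (left_ne_zero_of_mul hP)
  have hN₀' : (N : ℝ) ≠ 0 := Nat.cast_ne_zero.2 hN₀
  have hm : (1 : ℝ) ≤ m := mod_cast Nat.one_le_iff_ne_zero.2 (right_ne_zero_of_mul hP)
  calc (B * (m + m ^ 2) : ℝ) ≤ B * (m ^ 2 + m ^ 2) := by
        gcongr
        exact le_self_pow₀ hm two_ne_zero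
    _ = 2 * B * m ^ 2 * ((N : ℝ) / N) ^ 2 := by
        rw [div_self hN₀']
        ring
    _ ≤ 2 * B * m ^ 2 * (c * ℓ / N) ^ 2 := by gcongr
    _ = 2 * c ^ 2 * (((B * m * ℓ : ℕ) : ℝ) ^ 2 / (B * (N : ℝ) ^ 2)) := by
        push_cast
        field_simp

theorem scheme1_storageSize_le (hP : B * m ≠ 0) (hℓ : ℓ ≠ 0) :
    (scheme1 f α B m Ku Kd).storageSize ≤ 2 * (((B * m * ℓ : ℕ) : ℝ) ^ 2 / B) :=
  scheme1_storageSize.trans_le (uncoded_size_le hP hℓ)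

theorem scheme2_storageSize_le (hP : B * m ≠ 0) (hℓ : ℓ ≠ 0) (hN : N = 3 * ℓ + 1) :
    (scheme2 α B m ℓ Ku Kd).storageSize ≤
      32 * (((B * m * ℓ : ℕ) : ℝ) ^ 2 / (B * (N : ℝ) ^ 2)) := by
  have hN' : (N : ℝ) ≤ 4 * ℓ := mod_cast (by omega : N ≤ 4 * ℓ)
  have hsize := coded_size_le hP (by omega) hN'
  rw [scheme2_storageSize]
  linarith

theorem scheme3_storageSize_le (hP : B * m ≠ 0) (hℓ : ℓ ≠ 0) (hN : N = 2 * ℓ + 4) :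
    (scheme3 f α B m Ku Kd).storageSize ≤
      3 * max (((B * m * ℓ : ℕ) : ℝ) ^ 2 / B) ((N : ℝ) ^ 2 * (B : ℝ) ^ 2) := by
  have hN' : (ℓ : ℝ) ≤ N := mod_cast (by omega : ℓ ≤ N)
  have hinter : (B * ℓ : ℝ) ^ 2 ≤ (N : ℝ) ^ 2 * (B : ℝ) ^ 2 := by
    rw [mul_comm (B : ℝ), mul_pow]
    gcongr
  have hsize := uncoded_size_le hP hℓ
  rw [scheme3_storageSize]
  linarith [le_max_left (((B * m * ℓ : ℕ) : ℝ) ^ 2 / B) ((N : ℝ) ^ 2 * (B : ℝ) ^ 2),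
    le_max_right (((B * m * ℓ : ℕ) : ℝ) ^ 2 / B) ((N : ℝ) ^ 2 * (B : ℝ) ^ 2)]

theorem scheme4_storageSize_le (hP : B * m ≠ 0) (hℓ : ℓ ≠ 0) (hN : N = 5 * ℓ + 1) :
    (scheme4 α B m ℓ Ku Kd).storageSize ≤
      73 * max (((B * m * ℓ : ℕ) : ℝ) ^ 2 / ((N : ℝ) ^ 2 * B)) ((B : ℝ) ^ 2) := by
  have hN' : (N : ℝ) ≤ 6 * ℓ := mod_cast (by omega : N ≤ 6 * ℓ)
  have hsize := coded_size_le hP (by omega) hN'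
  rw [mul_comm (B : ℝ) ((N : ℝ) ^ 2)] at hsize
  rw [scheme4_storageSize]
  linarith [le_max_left (((B * m * ℓ : ℕ) : ℝ) ^ 2 / ((N : ℝ) ^ 2 * B)) ((B : ℝ) ^ 2),
    le_max_right (((B * m * ℓ : ℕ) : ℝ) ^ 2 / ((N : ℝ) ^ 2 * B)) ((B : ℝ) ^ 2)]

end Storage

end PRUW

theorem theorem1 :
    -- one absolute constant for the orders of the four storage complexities
    ∃ C : ℝ, ∀ (F : Type u) [Field F] [Fintype F] (N P B m ℓ L Ku Kd : ℕ) (r r' : ℝ),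
      1 ≤ B → B < P → P = B * m → 1 ≤ ℓ → L = P * ℓ →
      (Ku : ℝ) = P * r → (Kd : ℝ) = P * r' →
      -- case 1
      (∀ (f : Fin ℓ → F) (α : Fin N → F), Function.Injective f → Function.Injective α →
        (∀ i n, f i ≠ α n) → N = 2 * ℓ + 2 →
        (PRUW.scheme1 f α B m Ku Kd).Achieves PRUW.segCounts
          (2 * r' * (1 + Real.logb (Fintype.card F) P / N) / (1 - 2 / N))
          (2 * r * (1 + Real.logb (Fintype.card F) P) / (1 - 2 / N)) ∧
        (PRUW.scheme1 f α B m Ku Kd).storageSize ≤ C * ((L : ℝ) ^ 2 / B)) ∧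
      -- case 2
      (∀ α : Fin N → F, Function.Injective α → (∀ n, α n ≠ 0) → N = 3 * ℓ + 1 →
        (PRUW.scheme2 α B m ℓ Ku Kd).Achieves PRUW.segCounts
          (3 * r' * (1 + Real.logb (Fintype.card F) P / N) / (1 - 1 / N))
          (3 * r * (1 + Real.logb (Fintype.card F) P) / (1 - 1 / N)) ∧
        (PRUW.scheme2 α B m ℓ Ku Kd).storageSize ≤ C * ((L : ℝ) ^ 2 / (B * (N : ℝ) ^ 2))) ∧
      -- case 3
      (∀ (f : Fin ℓ → F) (α : Fin N → F), Function.Injective f → Function.Injective α →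
        (∀ i n, f i ≠ α n) → N = 2 * ℓ + 4 →
        (PRUW.scheme3 f α B m Ku Kd).Achieves PRUW.unorderedCounts
          (2 * r' * (1 + Real.logb (Fintype.card F) P / N) / (1 - 4 / N))
          (2 * r * (1 + Real.logb (Fintype.card F) P) / (1 - 4 / N)) ∧
        (PRUW.scheme3 f α B m Ku Kd).storageSize ≤
          C * max ((L : ℝ) ^ 2 / B) ((N : ℝ) ^ 2 * (B : ℝ) ^ 2)) ∧
      -- case 4
      (∀ α : Fin N → F, Function.Injective α → (∀ n, α n ≠ 0) → N = 5 * ℓ + 1 →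
        (PRUW.scheme4 α B m ℓ Ku Kd).Achieves PRUW.unorderedCounts
          (5 * r' * (1 + Real.logb (Fintype.card F) P / N) / (1 - 1 / N))
          (5 * r * (1 + Real.logb (Fintype.card F) P) / (1 - 1 / N)) ∧
        (PRUW.scheme4 α B m ℓ Ku Kd).storageSize ≤
          C * max ((L : ℝ) ^ 2 / ((N : ℝ) ^ 2 * B)) ((B : ℝ) ^ 2)) := by
  refine ⟨73, fun F _ _ N P B m ℓ L Ku Kd r r' hB hBP hP hℓ hL hKu hKd => ?_⟩
  subst hP hL
  have hP₀ : B * m ≠ 0 := by omega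
  have hℓ₀ : ℓ ≠ 0 := by omega
  refine ⟨fun f α hf hα hfα hN => ⟨PRUW.scheme1_achieves hf hα hfα hP₀ hℓ₀ hN hKu hKd,
      (PRUW.scheme1_storageSize_le hP₀ hℓ₀).trans ?_⟩,
    fun α hα hα₀ hN => ⟨PRUW.scheme2_achieves hα hα₀ hP₀ hℓ₀ hN hKu hKd,
      (PRUW.scheme2_storageSize_le hP₀ hℓ₀ hN).trans ?_⟩,
    fun f α hf hα hfα hN => ⟨PRUW.scheme3_achieves hf hα hfα hP₀ hℓ₀ hN hKu hKd,
      (PRUW.scheme3_storageSize_le hP₀ hℓ₀ hN).trans ?_⟩,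
    fun α hα hα₀ hN => ⟨PRUW.scheme4_achieves hα hα₀ hP₀ hℓ₀ hN hKu hKd,
      PRUW.scheme4_storageSize_le hP₀ hℓ₀ hN⟩⟩
  all_goals gcongr; norm_num
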